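/- Let $p,\rho:\mathbb R^d\to(0,\infty)$ be continuously differentiable, with $\int p=1$, and let $k:\mathbb R^d\times\mathbb R^d\to\mathbb R$ be a positive (semi)definite kernel of class $C^2$. Write $w=\rho/p$, $s_\rho=\nabla\log\rho$, and, for a scalar function $f$ and a vector field $F$, $\mathcal S_\rho f=s_\rho f+\nabla f$ and $\mathcal S_\rho^\top F=s_\rho^\top F+\operatorname{div}F$. Put $\kappa_\rho(x,y)=(\mathcal S_\rho^{y})^{\top}\big(\mathcal S_\rho^{x}k(x,y)\big)$, where the superscript names the variable in which the operator acts. Let $I\subseteq\mathbb R$ be an interval and let $a:\mathbb R^d\to\mathbb R$ be a continuously differentiable speed factor. Let $(x^t)_{t\in I}$ be random variables on a probability space such that $x^t$ has a density $q_t$ with $(t,x)\mapsto q_t(x)$ continuously differentiable on $I\times\mathbb R^d$, and such that almost every trajectory solves on $I$ the mean-field equation $$\frac{dx^t}{dt}=a(x^t)\,\phi_t(x^t),\qquad \phi_t(y)=\mathbb E_{x\sim q_t}\big[w(x)\big(s_\rho(x)k(x,y)+\nabla_xk(x,y)\big)\big].$$ Assume that $\mathbb E_{x\sim q_t}\big[w(x)\sqrt{\kappa_\rho(x,x)}\big]$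 is finite and depends continuously on $t\in I$. Then the following hold (time derivatives are one-sided at an end point of $I$ that belongs to $I$). 1. The expectation defining $\phi_t(y)$ exists for all $t\in I$ and $y\in\mathbb R^d$, the field $q_t\,a\,\phi_t$ is differentiable, and $q_t$ satisfies the continuity equation $$\frac{\partial q_t}{\partial t}=-\operatorname{div}\big(q_t\,a\,\phi_t\big)\qquad\text{on } I\times\mathbb R^d .$$ In particular, this holds for $a\equiv1$, that is, for $dx^t/dt=\mathbb E_{x\sim q_t}[w(x)(s_\rho(x)k(x,x^t)+\nabla_xk(x,x^t))]$. 2. Suppose that $a=w$, that is, $dx^t/dt=w(x^t)\,\mathbb E_{x\sim q_t}[w(x)(s_\rho(x)k(x,x^t)+\nabla_xk(x,x^t))]$, and that $\mathrm{KL}(q_{t_0}\|p)<\infty$ for some $t_0\in I$. Then, for every $t\in I$, $\mathrm{KL}(q_t\|p)<\infty$, the function $w(x)w(x')\kappa_\rho(x,x')$ is integrable with respect to $q_t\otimes q_t$, and $$\frac{d}{dt}\mathrm{KL}(q_t\|p)=-\mathbb E_{x,x'\sim q_t}\big[w(x)w(x')\kappa_\rho(x,x')\big]\le0 .$$ 3.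 For all $x,y\in\mathbb R^d$, $$\kappa_\rho(x,y)=s_\rho(x)^\top k(x,y)s_\rho(y)+s_\rho(x)^\top\nabla_yk(x,y)+s_\rho(y)^\top\nabla_xk(x,y)+\nabla_x\cdot\big(\nabla_yk(x,y)\big).$$ -/

import Mathlib

open MeasureTheory ProbabilityTheory Set

open scoped ENNReal

noncomputable section

namespace GFSVGD

/-- The Euclidean space of dimension `d`. -/
abbrev Space (d : ℕ) : Type := EuclideanSpace ℝ (Fin d)

variable {d : ℕ}

/-- The measure with density `f` with respect to Lebesgue measure. -/
def densityMeasure (f : Space d → ℝ) : Measure (Space d) :=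
  volume.withDensity fun x => ENNReal.ofReal (f x)

/-- The divergence `∑ i, ∂ F_i / ∂ x_i` of a vector field. -/
def divergence (F : Space d → Space d) (x : Space d) : ℝ :=
  ∑ i : Fin d, (fderiv ℝ F x (EuclideanSpace.single i 1)) i

/-- The score function `s_ρ = ∇ log ρ`. -/
def score (ρ : Space d → ℝ) (x : Space d) : Space d :=
  gradient (fun y => Real.log (ρ y)) x

/-- The importance weight `w = ρ / p`. -/
def weight (p ρ : Space d → ℝ) (x : Space d) : ℝ := ρ x / p x

/-- The Stein operator of `ρ` on scalar functions, `f ↦ s_ρ f + ∇ f`. -/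
def steinScalar (ρ f : Space d → ℝ) (x : Space d) : Space d :=
  f x • score ρ x + gradient f x

/-- The Stein operator of `ρ` on vector fields, `F ↦ s_ρᵀ F + div F`. -/
def steinVector (ρ : Space d → ℝ) (F : Space d → Space d) (x : Space d) : ℝ :=
  inner ℝ (score ρ x) (F x) + divergence F x

/-- The kernel `κ_ρ(x, y)`: the scalar Stein operator is applied to `k` in the first variable,
then the vector Stein operator is applied in the second variable. -/
def steinKernel (ρ : Space d → ℝ) (k : Space d → Space d → ℝ) (x y : Space d) : ℝ :=
  steinVector ρ (fun y' => steinScalar ρ (fun x' => k x' y') x) y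

/-- The integrand `w(x) (s_ρ(x) k(x, y) + ∇_x k(x, y))`. -/
def drift (p ρ : Space d → ℝ) (k : Space d → Space d → ℝ) (x y : Space d) : Space d :=
  weight p ρ x • steinScalar ρ (fun x' => k x' y) x

/-- The mean field `y ↦ E_{x ∼ μ} [w(x) (s_ρ(x) k(x, y) + ∇_x k(x, y))]`. -/
def meanField (p ρ : Space d → ℝ) (k : Space d → Space d → ℝ) (μ : Measure (Space d))
    (y : Space d) : Space d :=
  ∫ x, drift p ρ k x y ∂μ

/-- On the time interval `I`, the random variables `X t` have the continuously differentiable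
density `q t`, and almost every trajectory solves the mean-field equation
`dX/dt = a(X) E_{x ∼ q t} [w(x) (s_ρ(x) k(x, X) + ∇_x k(x, X))]`
with position-dependent speed factor `a`. -/
structure IsMeanFieldFlow {Ω : Type*} [MeasurableSpace Ω] (P : Measure Ω)
    (p ρ : Space d → ℝ) (k : Space d → Space d → ℝ) (a : Space d → ℝ)
    (I : Set ℝ) (X : ℝ → Ω → Space d) (q : ℝ → Space d → ℝ) : Prop where
  density_nonneg : ∀ t ∈ I, ∀ x, 0 ≤ q t x
  density_contDiffOn : ContDiffOn ℝ 1 (fun z : ℝ × Space d => q z.1 z.2) (I ×ˢ univ)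
  hasLaw : ∀ t ∈ I, HasLaw (X t) (densityMeasure (q t)) P
  ode : ∀ᵐ ω ∂P, ∀ t ∈ I,
    HasDerivWithinAt (fun s => X s ω)
      (a (X t ω) • meanField p ρ k (densityMeasure (q t)) (X t ω)) I t

end GFSVGD

end

/-! Everything reduces to one Hilbert-space vector. A positive semidefinite kernel factors as `k x y
= ⟨K x, K y⟩`, and for `k` of class C² the map `K` is C¹ (`contDiff_featureMap`). Put `Φ(x)_i =
s_ρ(x)_i K x + ∂_i K x` (`steinFeature`). Then `κ_ρ(x,y) = ⟨Φ x, Φ y⟩`, so `√κ_ρ(x,x) = ‖Φ x‖` and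
the moment assumption says that `w Φ` is Bochner integrable. With `m_t = E[w Φ]` (`meanFeature`) one
gets `φ_t(y)_i = ⟨(m_t)_i, K y⟩`, a C¹ field with `S_ρᵀ φ_t = ⟨m_t, Φ⟩`, while the double
expectation of `w w' κ_ρ` equals `‖m_t‖²`. Scheffé's lemma and the assumed continuity of `E‖w Φ‖`
make `t ↦ m_t` continuous.

The continuity equation is proved weakly: for a test function `ψ`, `E ψ(X_t) = ∫ ψ q_t` is
differentiated along trajectories and under the integral. Both densities obtained are continuous,
hence equal everywhere.

For the entropy, nothing is known about decay at infinity, so the integral of `q log (q/p)` is not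
differentiated directly. Instead `q_t/p` is followed along a trajectory: since `w p = ρ`, it solves
the linear equation `z' = -⟨m_t, w Φ(X_t)⟩ z`. Taking logarithms, expectations and Fubini gives
`KL(q_s) = KL(q_t) - ∫_t^s ‖m_r‖² dr` (`integral_log_density_ratio_sub`). This propagates finiteness
to all times, and its derivative in `s` is the dissipation formula. -/

noncomputable section

namespace GFSVGD

open Filter Topology

/-! ### Feature map of a C² kernel and its C¹ regularity. -/

section FeatureMap

/-- A positive semidefinite real kernel has a feature map into a Hilbert space. -/
theorem exists_featureMap {S : Type} (k : S → S → ℝ) (hk : (Matrix.of k).PosSemidef) :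
    ∃ (H : Type) (_ : NormedAddCommGroup H) (_ : InnerProductSpace ℝ H) (_ : CompleteSpace H)
      (K : S → H), ∀ x y, k x y = inner ℝ (K x) (K y) := by
  -- The scalar kernel is read as an operator-valued kernel on `ℝ`; the feature at `x` is then the
  -- kernel function applied to `1`.
  let κ : Matrix S S (ℝ →L[ℝ] ℝ) := Matrix.of fun x y => k x y • ContinuousLinearMap.id ℝ ℝ
  have hκ : κ.PosSemidef := by
    have htfae := (RKHS.posSemidef_tfae (K := κ)).out 0 2
    refine htfae.mpr ⟨?_, fun v => ?_⟩
    · ext x y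
      have := hk.1.apply x y
      simp only [Matrix.of_apply, star_trivial] at this
      simp only [κ, Matrix.conjTranspose_apply, Matrix.of_apply, this, star_smul, star_trivial,
        ContinuousLinearMap.star_eq_adjoint, ContinuousLinearMap.adjoint_id]
    · have := hk.2 v
      simp only [Matrix.of_apply, star_trivial] at this
      rw [Finsupp.sum_comm]
      refine this.trans_eq ?_
      simp [κ, mul_comm, mul_left_comm]
  have : Fact κ.PosSemidef := ⟨hκ⟩
  refine ⟨RKHS.OfKernel κ, inferInstance, inferInstance, inferInstance,
    fun x => RKHS.kerFun (RKHS.OfKernel κ) x 1, fun x y => ?_⟩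
  rw [real_inner_comm, ← RKHS.kernel_inner, RKHS.OfKernel.kernel_ofKernel]
  simp [κ]

theorem eventually_norm_fderiv_fderiv_sub_lt {G : Type*} [NormedAddCommGroup G] [NormedSpace ℝ G]
    {f : G → ℝ} (hf : ContDiff ℝ 2 f) (z₀ : G) {ε : ℝ} (hε : 0 < ε) :
    ∀ᶠ z in 𝓝 z₀, ‖fderiv ℝ (fderiv ℝ f) z - fderiv ℝ (fderiv ℝ f) z₀‖ < ε := by
  have hf1 : ContDiff ℝ 1 (fderiv ℝ f) := hf.fderiv_right (by norm_num)
  have hc : Continuous (fderiv ℝ (fderiv ℝ f)) := hf1.continuous_fderiv (by norm_num)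
  exact ((tendsto_iff_norm_sub_tendsto_zero (E := G →L[ℝ] G →L[ℝ] ℝ)).1
    (hc.tendsto z₀)).eventually (gt_mem_nhds hε)

/-- Second-order expansion of the mixed second difference of a `C²` function. -/
theorem exists_mixed_difference_le {E F : Type*} [NormedAddCommGroup E] [NormedSpace ℝ E]
    [NormedAddCommGroup F] [NormedSpace ℝ F] {f : E × F → ℝ} (hf : ContDiff ℝ 2 f)
    (x : E) (y : F) {ε : ℝ} (hε : 0 < ε) :
    ∃ δ > 0, ∀ h h', ‖h‖ < δ → ‖h'‖ < δ →
      |f (x + h, y + h') - f (x, y + h') - (f (x + h, y) - f (x, y))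
        - fderiv ℝ (fderiv ℝ f) (x, y) (h, 0) (0, h')| ≤ ε * ‖h‖ * ‖h'‖ := by
  have hf1 : ContDiff ℝ 1 (fderiv ℝ f) := hf.fderiv_right (by norm_num)
  have hd : Differentiable ℝ f := hf.differentiable (by norm_num)
  have hd1 : Differentiable ℝ (fderiv ℝ f) := hf1.differentiable (by norm_num)
  have hev : ∀ᶠ z in 𝓝 (x, y),
      ‖fderiv ℝ (fderiv ℝ f) z - fderiv ℝ (fderiv ℝ f) (x, y)‖ < ε := by
    exact eventually_norm_fderiv_fderiv_sub_lt hf (x, y) hε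
  obtain ⟨δ, hδ, hb⟩ := Metric.eventually_nhds_iff.1 hev
  have hb' : ∀ u ∈ Metric.ball x δ, ∀ v ∈ Metric.ball y δ,
      ‖fderiv ℝ (fderiv ℝ f) (u, v) - fderiv ℝ (fderiv ℝ f) (x, y)‖ ≤ ε := by
    intro u hu v hv
    exact (hb (y := (u, v)) (by rw [Prod.dist_eq]; exact max_lt hu hv)).le
  refine ⟨δ, hδ, fun h h' hh hh' => ?_⟩
  have hxh : x + h ∈ Metric.ball x δ := by simpa [dist_eq_norm] using hh
  have hyh : y + h' ∈ Metric.ball y δ := by simpa [dist_eq_norm] using hh'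
  have hx : x ∈ Metric.ball x δ := Metric.mem_ball_self hδ
  have hy : y ∈ Metric.ball y δ := Metric.mem_ball_self hδ
  -- Mean value inequality twice: here for `f'` in the first variable, then in the second variable
  -- for `v ↦ f (x + h, v) - f (x, v)`, whose derivative `step1` controls.
  have step1 : ∀ v ∈ Metric.ball y δ,
      ‖fderiv ℝ f (x + h, v) - fderiv ℝ f (x, v) - fderiv ℝ (fderiv ℝ f) (x, y) (h, 0)‖
        ≤ ε * ‖h‖ := by
    intro v hv
    have := (convex_ball x δ).norm_image_sub_le_of_norm_hasFDerivWithin_le'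
      (f := fun u => fderiv ℝ f (u, v))
      (f' := fun u => (fderiv ℝ (fderiv ℝ f) (u, v)).comp (ContinuousLinearMap.inl ℝ E F))
      (φ := (fderiv ℝ (fderiv ℝ f) (x, y)).comp (ContinuousLinearMap.inl ℝ E F)) (C := ε)
      (fun u _ => ((hd1 (u, v)).hasFDerivAt.comp u (hasFDerivAt_prodMk_left u v)).hasFDerivWithinAt)
      (fun u hu => by
        rw [← ContinuousLinearMap.sub_comp]
        refine (ContinuousLinearMap.opNorm_comp_le _ _).trans ?_
        refine (mul_le_mul (hb' u hu v hv) (ContinuousLinearMap.norm_inl_le_one ℝ E F)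
          (norm_nonneg _) hε.le).trans (by simp)) hx hxh
    simpa using this
  have step2 := (convex_ball y δ).norm_image_sub_le_of_norm_hasFDerivWithin_le'
      (f := fun v => f (x + h, v) - f (x, v))
      (f' := fun v => (fderiv ℝ f (x + h, v) - fderiv ℝ f (x, v)).comp
        (ContinuousLinearMap.inr ℝ E F))
      (φ := (fderiv ℝ (fderiv ℝ f) (x, y) (h, 0)).comp (ContinuousLinearMap.inr ℝ E F))
      (C := ε * ‖h‖)
      (fun v _ => by
        rw [ContinuousLinearMap.sub_comp]
        exact (((hd (x + h, v)).hasFDerivAt.comp v (hasFDerivAt_prodMk_right (x + h) v)).sub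
          ((hd (x, v)).hasFDerivAt.comp v (hasFDerivAt_prodMk_right x v))).hasFDerivWithinAt)
      (fun v hv => by
        rw [← ContinuousLinearMap.sub_comp]
        refine (ContinuousLinearMap.opNorm_comp_le _ _).trans ?_
        refine (mul_le_mul (step1 v hv) (ContinuousLinearMap.norm_inr_le_one ℝ E F)
          (norm_nonneg _) (by positivity)).trans (by simp)) hy hyh
  simpa using step2

variable {H : Type*} [NormedAddCommGroup H] [InnerProductSpace ℝ H]

/-- Increments of a feature map are almost additive near a point when the kernel is `C²`. -/
theorem exists_norm_sum_increment_le {E : Type*} [NormedAddCommGroup E] [NormedSpace ℝ E]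
    {K : E → H}
    (hK : ContDiff ℝ 2 fun z : E × E => (inner ℝ (K z.1) (K z.2) : ℝ)) (x : E) {ε : ℝ}
    (hε : 0 < ε) :
    ∃ δ > 0, ∀ (ι : Type) [Fintype ι] (c : ι → ℝ) (h : ι → E), (∀ i, ‖h i‖ < δ) →
      ∑ i, c i • h i = 0 →
      ‖∑ i, c i • (K (x + h i) - K x)‖ ≤ ε * ∑ i, |c i| * ‖h i‖ := by
  -- The tolerance is `ε ^ 2` because the squared norm of the sum is what gets expanded.
  obtain ⟨δ, hδ, hb⟩ := exists_mixed_difference_le hK x x (pow_pos hε 2)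
  refine ⟨δ, hδ, fun ι _ c h hh hsum => ?_⟩
  set f := fun z : E × E => (inner ℝ (K z.1) (K z.2) : ℝ) with hf
  set B := fun h h' : E => fderiv ℝ (fderiv ℝ f) (x, x) (h, 0) (0, h') with hB
  -- The leading bilinear term vanishes because `∑ c i • h i = 0`; only the second-difference errors
  -- survive.
  have hBsum : ∑ i, ∑ j, c i * c j * B (h i) (h j) = 0 := by
    have : fderiv ℝ (fderiv ℝ f) (x, x) (∑ i, c i • h i, 0) (0, ∑ j, c j • h j)
        = ∑ i, ∑ j, c i * c j * B (h i) (h j) := by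
      have e1 : ((∑ i, c i • h i, 0) : E × E) = ∑ i, c i • (h i, (0 : E)) := by
        rw [Prod.ext_iff]; simp [Prod.fst_sum, Prod.snd_sum]
      have e2 : ((0, ∑ i, c i • h i) : E × E) = ∑ i, c i • ((0 : E), h i) := by
        rw [Prod.ext_iff]; simp [Prod.fst_sum, Prod.snd_sum]
      rw [e1, e2]
      simp only [map_sum, map_smul, sum_apply, hB, smul_eq_mul,
        smul_apply, Finset.mul_sum, mul_assoc]
      rw [Finset.sum_comm]
      exact Finset.sum_congr rfl fun i _ => Finset.sum_congr rfl fun j _ => by ring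
    rw [← this, hsum, Prod.mk_zero_zero, map_zero]
  have key : ∀ i j, |c i * c j * inner ℝ (K (x + h i) - K x) (K (x + h j) - K x)
      - c i * c j * B (h i) (h j)| ≤ ε ^ 2 * ((|c i| * ‖h i‖) * (|c j| * ‖h j‖)) := by
    intro i j
    have h1 := hb (h i) (h j) (hh i) (hh j)
    have h2 : (inner ℝ (K (x + h i) - K x) (K (x + h j) - K x) : ℝ) =
        f (x + h i, x + h j) - f (x, x + h j) - (f (x + h i, x) - f (x, x)) := by
      simp only [hf, inner_sub_left, inner_sub_right]
    rw [← mul_sub, abs_mul, abs_mul, h2]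
    calc _ ≤ |c i| * |c j| * (ε ^ 2 * ‖h i‖ * ‖h j‖) := by gcongr
      _ = _ := by ring
  have hsq : ‖∑ i, c i • (K (x + h i) - K x)‖ ^ 2 ≤ (ε * ∑ i, |c i| * ‖h i‖) ^ 2 := by
    rw [← real_inner_self_eq_norm_sq]
    calc inner ℝ (∑ i, c i • (K (x + h i) - K x)) (∑ i, c i • (K (x + h i) - K x))
        = ∑ i, ∑ j, (c i * c j * inner ℝ (K (x + h i) - K x) (K (x + h j) - K x)
            - c i * c j * B (h i) (h j)) := by
          simp only [Finset.sum_sub_distrib, hBsum, sub_zero]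
          rw [sum_inner]
          refine Finset.sum_congr rfl fun i _ => ?_
          rw [inner_sum]
          refine Finset.sum_congr rfl fun j _ => ?_
          rw [inner_smul_left, inner_smul_right]
          simp [mul_assoc]
      _ ≤ ∑ i, ∑ j, ε ^ 2 * ((|c i| * ‖h i‖) * (|c j| * ‖h j‖)) :=
          Finset.sum_le_sum fun i _ => Finset.sum_le_sum fun j _ =>
            (le_abs_self _).trans (key i j)
      _ = _ := by
          rw [mul_pow, sq (∑ i, |c i| * ‖h i‖), Finset.sum_mul_sum]
          simp only [Finset.mul_sum]
  have h0 : 0 ≤ ∑ i, |c i| * ‖h i‖ := Finset.sum_nonneg fun i _ => by positivity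
  exact (sq_le_sq₀ (norm_nonneg _) (by positivity)).1 hsq

variable [CompleteSpace H] {n : ℕ} {K : Space n → H}

/-- The feature map of a `C²` kernel has directional derivatives. -/
theorem exists_tendsto_slope
    (hK : ContDiff ℝ 2 fun z : Space n × Space n => (inner ℝ (K z.1) (K z.2) : ℝ))
    (x e : Space n) :
    ∃ v, Tendsto (fun s : ℝ => s⁻¹ • (K (x + s • e) - K x)) (𝓝[≠] 0) (𝓝 v) := by
  refine cauchy_map_iff_exists_tendsto.1 ?_
  rw [Metric.cauchy_iff]
  refine ⟨inferInstance, fun η hη => ?_⟩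
  -- Each of the two slopes compared below contributes weight `‖e‖`; the `+ 1` covers `e = 0` and
  -- makes the bound strict.
  obtain ⟨δ, hδ, hb⟩ := exists_norm_sum_increment_le hK x
    (show 0 < η / (2 * ‖e‖ + 1) by positivity)
  have hsmall : ∀ᶠ s : ℝ in 𝓝[≠] 0, ‖s • e‖ < δ := by
    have : Tendsto (fun s : ℝ => ‖s • e‖) (𝓝 0) (𝓝 0) := by
      have : Continuous fun s : ℝ => ‖s • e‖ := by fun_prop
      simpa using this.tendsto 0
    exact (this.mono_left nhdsWithin_le_nhds).eventually (gt_mem_nhds hδ)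
  refine ⟨_, image_mem_map (hsmall.and self_mem_nhdsWithin), ?_⟩
  rintro _ ⟨s, ⟨hs, hs0⟩, rfl⟩ _ ⟨r, ⟨hr, hr0⟩, rfl⟩
  have hs0 : s ≠ 0 := hs0
  have hr0 : r ≠ 0 := hr0
  have := hb (Fin 2) ![s⁻¹, -r⁻¹] ![s • e, r • e]
    (by intro i; fin_cases i <;> simpa) (by simp [smul_smul, hs0, hr0])
  simp only [Fin.sum_univ_two, Matrix.cons_val_zero, Matrix.cons_val_one, norm_smul,
    Real.norm_eq_abs, abs_neg, abs_inv, neg_smul] at this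
  rw [← mul_assoc, ← mul_assoc, inv_mul_cancel₀ (abs_ne_zero.2 hs0),
    inv_mul_cancel₀ (abs_ne_zero.2 hr0), ← sub_eq_add_neg] at this
  rw [dist_eq_norm]
  refine this.trans_lt ?_
  rw [div_mul_eq_mul_div, div_lt_iff₀ (by positivity)]
  nlinarith [norm_nonneg e]

/-- The remainder `K (x + h) - K x - T h` is the limit, as `s → 0`, of a combination of increments
at `h` and at `s e_i` with coefficients `1` and `-h_i / s`. The displacements cancel and the total
weight is at most `(1 + n) ‖h‖`, uniformly in `s`. -/
theorem differentiable_featureMap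
    (hK : ContDiff ℝ 2 fun z : Space n × Space n => (inner ℝ (K z.1) (K z.2) : ℝ)) :
    Differentiable ℝ K := by
  intro x
  choose v hv using fun i : Fin n => exists_tendsto_slope hK x (EuclideanSpace.single i 1)
  let T : Space n →L[ℝ] H := ∑ i, (EuclideanSpace.proj i : Space n →L[ℝ] ℝ).smulRight (v i)
  refine ⟨T, ?_⟩
  rw [hasFDerivAt_iff_isLittleO_nhds_zero, Asymptotics.isLittleO_iff]
  intro η hη
  obtain ⟨δ, hδ, hb⟩ := exists_norm_sum_increment_le hK x
    (show 0 < η / (1 + n) by positivity)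
  filter_upwards [Metric.ball_mem_nhds (0 : Space n) hδ] with h hh
  have hh : ‖h‖ < δ := by simpa using hh
  have hT : T h = ∑ i, h i • v i := by simp [T]
  rw [hT]
  have hlim : Tendsto (fun s : ℝ => ‖K (x + h) - K x -
      ∑ i, h i • (s⁻¹ • (K (x + s • EuclideanSpace.single i 1) - K x))‖) (𝓝[≠] 0)
      (𝓝 ‖K (x + h) - K x - ∑ i, h i • v i‖) :=
    (tendsto_const_nhds.sub (tendsto_finsetSum _ fun i _ => (hv i).const_smul (h i))).norm
  refine le_of_tendsto hlim ?_
  have hsmall : ∀ᶠ s : ℝ in 𝓝[≠] 0, |s| < δ := by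
    have : Tendsto (fun s : ℝ => |s|) (𝓝 0) (𝓝 0) := by simpa using (continuous_abs.tendsto (0 : ℝ))
    exact (this.mono_left nhdsWithin_le_nhds).eventually (gt_mem_nhds hδ)
  filter_upwards [hsmall, self_mem_nhdsWithin] with s hs hs0
  have hs0 : s ≠ 0 := hs0
  have := hb (Option (Fin n)) (fun o => o.elim 1 fun i => -(h i * s⁻¹))
    (fun o => o.elim h fun i => s • EuclideanSpace.single i 1)
    (by rintro (_ | i) <;> simp [norm_smul, hh, hs]) (by
      simp only [Fintype.sum_option, Option.elim_none, Option.elim_some, one_smul, smul_smul,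
        neg_mul, neg_smul]
      ext j
      simp [hs0, Finset.sum_apply, Pi.single_apply])
  simp only [Fintype.sum_option, Option.elim_none, Option.elim_some, one_smul, neg_smul,
    Finset.sum_neg_distrib, ← sub_eq_add_neg, mul_smul] at this
  refine this.trans ?_
  have hle : ∑ i : Fin n, |(-(h i * s⁻¹))| * ‖s • (EuclideanSpace.single i 1 : Space n)‖
      ≤ n * ‖h‖ := by
    calc _ ≤ ∑ i : Fin n, ‖h‖ := by
          refine Finset.sum_le_sum fun i _ => ?_
          have := PiLp.norm_apply_le h i
          rw [norm_smul, abs_neg, abs_mul, abs_inv, Real.norm_eq_abs]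
          have h1 : |s| ≠ 0 := abs_ne_zero.2 hs0
          simp only [PiLp.norm_single, norm_one, mul_one]
          rw [mul_assoc, inv_mul_cancel₀ h1, mul_one]
          exact this
      _ = _ := by simp
  calc _ ≤ η / (1 + n) * (‖h‖ + n * ‖h‖) := by
        rw [abs_one, one_mul]; gcongr
    _ = η * ‖h‖ := by field_simp

/-- The feature map of a `C²` kernel is `C¹`. -/
theorem contDiff_featureMap
    (hK : ContDiff ℝ 2 fun z : Space n × Space n => (inner ℝ (K z.1) (K z.2) : ℝ)) :
    ContDiff ℝ 1 K := by
  have hd := differentiable_featureMap hK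
  refine contDiff_one_iff_fderiv.2 ⟨hd, ?_⟩
  rw [continuous_clm_apply]
  intro e
  set f := fun z : Space n × Space n => (inner ℝ (K z.1) (K z.2) : ℝ) with hf
  have hf1 : ContDiff ℝ 1 (fderiv ℝ f) := hK.fderiv_right (by norm_num)
  have hd1 : Differentiable ℝ (fderiv ℝ f) := hf1.differentiable (by norm_num)
  have hc : Continuous (fderiv ℝ (fderiv ℝ f)) := hf1.continuous_fderiv (by norm_num)
  have h1 : ∀ x y, fderiv ℝ f (x, y) (e, 0) = inner ℝ (fderiv ℝ K x e) (K y) := by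
    intro x y
    have a : HasFDerivAt f _ (x, y) :=
      ((hd x).hasFDerivAt.comp (x, y) hasFDerivAt_fst).inner ℝ
      ((hd y).hasFDerivAt.comp (x, y) hasFDerivAt_snd)
    rw [a.fderiv]
    simp [fderivInnerCLM_apply]
  -- The mixed second derivative of `k` is the Gram function of `x ↦ K'(x) e`, which is therefore
  -- jointly continuous.
  have h2 : ∀ x y, fderiv ℝ (fderiv ℝ f) (x, y) (0, e) (e, 0)
      = inner ℝ (fderiv ℝ K x e) (fderiv ℝ K y e) := by
    intro x y
    have a := ((hd1 (x, y)).hasFDerivAt.comp y (hasFDerivAt_prodMk_right x y)).clm_apply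
      (hasFDerivAt_const ((e, 0) : Space n × Space n) y)
    have b := (innerSL ℝ (fderiv ℝ K x e)).hasFDerivAt.comp y (hd y).hasFDerivAt
    have hfun : (fun v => fderiv ℝ f (x, v) (e, 0)) = fun v => inner ℝ (fderiv ℝ K x e) (K v) :=
      funext fun v => h1 x v
    have a' : HasFDerivAt (fun v => fderiv ℝ f (x, v) (e, 0)) _ y := a
    rw [hfun] at a'
    have := congrArg (fun L => L e) (a'.unique b)
    simpa using this
  have hG : Continuous fun z : Space n × Space n =>
      (inner ℝ (fderiv ℝ K z.1 e) (fderiv ℝ K z.2 e) : ℝ) := by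
    have : (fun z : Space n × Space n =>
      (inner ℝ (fderiv ℝ K z.1 e) (fderiv ℝ K z.2 e) : ℝ)) =
      fun z => fderiv ℝ (fderiv ℝ f) z (0, e) (e, 0) := funext fun z => (h2 z.1 z.2).symm
    rw [this]
    fun_prop
  rw [continuous_iff_continuousAt]
  intro x
  rw [ContinuousAt, tendsto_iff_norm_sub_tendsto_zero]
  -- Expanding `‖K'(y) e - K'(x) e‖²` into Gram entries turns their continuity into norm continuity
  -- of `K'(·) e`.
  have hsq : Tendsto (fun y => √(inner ℝ (fderiv ℝ K y e) (fderiv ℝ K y e)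
      - 2 * inner ℝ (fderiv ℝ K y e) (fderiv ℝ K x e)
      + inner ℝ (fderiv ℝ K x e) (fderiv ℝ K x e))) (𝓝 x) (𝓝 0) := by
    have c : Continuous fun y => √(inner ℝ (fderiv ℝ K y e) (fderiv ℝ K y e)
      - 2 * inner ℝ (fderiv ℝ K y e) (fderiv ℝ K x e)
      + inner ℝ (fderiv ℝ K x e) (fderiv ℝ K x e)) := by
      have c1 := hG.comp (continuous_id.prodMk continuous_id)
      have c2 := hG.comp (continuous_id.prodMk (continuous_const (y := x)))
      exact ((c1.sub (c2.const_mul 2)).add continuous_const).sqrt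
    have := c.tendsto x
    convert this using 2
    symm
    rw [Real.sqrt_eq_zero']
    linarith
  refine hsq.congr fun y => ?_
  rw [Real.sqrt_eq_iff_mul_self_eq _ (norm_nonneg _), ← real_inner_self_eq_norm_mul_norm,
    inner_sub_left, inner_sub_right, inner_sub_right]
  · rw [real_inner_comm (fderiv ℝ K x e) (fderiv ℝ K y e)]; ring
  · have := real_inner_self_nonneg (x := fderiv ℝ K y e - fderiv ℝ K x e)
    rw [inner_sub_left, inner_sub_right, inner_sub_right,
      real_inner_comm (fderiv ℝ K y e) (fderiv ℝ K x e)] at this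
    linarith

end FeatureMap

/-! ### The Stein kernel as a Gram kernel. -/

section SteinFeature

variable {d : ℕ} {H : Type*} [NormedAddCommGroup H] [InnerProductSpace ℝ H]

/-- The feature map of the Stein kernel, with components `s_ρ(x)_i K_x + ∂_i K_x`. -/
def steinFeature (ρ : Space d → ℝ) (K : Space d → H) (x : Space d) :
    PiLp 2 (fun _ : Fin d => H) :=
  WithLp.toLp 2 fun i => score ρ x i • K x + fderiv ℝ K x (EuclideanSpace.single i 1)

/-- The vector field on `Space d` represented by a `d`-tuple of elements of the feature space. -/
def featureField (K : Space d → H) (M : PiLp 2 (fun _ : Fin d => H)) (y : Space d) : Space d :=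
  WithLp.toLp 2 fun i => inner ℝ (M i) (K y)

variable {ρ : Space d → ℝ} {k : Space d → Space d → ℝ} {K : Space d → H}

theorem gradient_apply {f : Space d → ℝ} (x : Space d) (i : Fin d) :
    gradient f x i = fderiv ℝ f x (EuclideanSpace.single i 1) := by
  rw [gradient, ← InnerProductSpace.toDual_symm_apply (𝕜 := ℝ) (y := fderiv ℝ f x),
    EuclideanSpace.inner_single_right]
  simp

theorem continuous_score (hρ : ContDiff ℝ 1 ρ) (hρ_pos : ∀ x, 0 < ρ x) :
    Continuous (score ρ) := by
  have : ContDiff ℝ 1 fun y => Real.log (ρ y) := hρ.log fun x => (hρ_pos x).ne'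
  exact (InnerProductSpace.toDual ℝ (Space d)).symm.continuous.comp
    (this.continuous_fderiv (by norm_num))

theorem continuous_steinFeature (hρ : ContDiff ℝ 1 ρ) (hρ_pos : ∀ x, 0 < ρ x)
    (hK : ContDiff ℝ 1 K) : Continuous (steinFeature ρ K) := by
  refine (PiLp.continuous_toLp 2 _).comp (continuous_pi fun i => ?_)
  have h1 := continuous_score hρ hρ_pos
  have h2 := hK.continuous
  have h3 := hK.continuous_fderiv (by norm_num)
  fun_prop

theorem contDiff_featureField (hK : ContDiff ℝ 1 K) (M : PiLp 2 (fun _ : Fin d => H)) :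
    ContDiff ℝ 1 (featureField K M) := by
  rw [contDiff_euclidean]
  exact fun i => contDiff_const.inner ℝ hK

theorem fderiv_featureField_apply (hK : ContDiff ℝ 1 K) (M : PiLp 2 (fun _ : Fin d => H))
    (y e : Space d) (i : Fin d) :
    (fderiv ℝ (featureField K M) y e) i = inner ℝ (M i) (fderiv ℝ K y e) := by
  have h1 := ((contDiff_featureField hK M).differentiable (by norm_num) y).hasFDerivAt
  have h2 := (EuclideanSpace.proj i : Space d →L[ℝ] ℝ).hasFDerivAt.comp y h1
  have h3 := (innerSL ℝ (M i)).hasFDerivAt.comp y (hK.differentiable (by norm_num) y).hasFDerivAt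
  exact congrArg (fun L => L e) (h2.unique h3)

theorem divergence_featureField (hK : ContDiff ℝ 1 K) (M : PiLp 2 (fun _ : Fin d => H))
    (y : Space d) :
    divergence (featureField K M) y
      = ∑ i, inner ℝ (M i) (fderiv ℝ K y (EuclideanSpace.single i 1)) :=
  Finset.sum_congr rfl fun i _ => fderiv_featureField_apply hK M y _ i

theorem norm_featureField_le (M : PiLp 2 (fun _ : Fin d => H)) (y : Space d) :
    ‖featureField K M y‖ ≤ ‖M‖ * ‖K y‖ := by
  refine (sq_le_sq₀ (norm_nonneg _) (by positivity)).1 ?_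
  rw [EuclideanSpace.norm_sq_eq, mul_pow, PiLp.norm_sq_eq_of_L2, Finset.sum_mul]
  refine Finset.sum_le_sum fun i _ => ?_
  rw [← mul_pow]
  exact pow_le_pow_left₀ (norm_nonneg _) (norm_inner_le_norm _ _) 2

/-- The vector Stein operator is the pairing with the Stein feature. -/
theorem steinVector_featureField (hK : ContDiff ℝ 1 K) (M : PiLp 2 (fun _ : Fin d => H))
    (y : Space d) :
    steinVector ρ (featureField K M) y = inner ℝ M (steinFeature ρ K y) := by
  rw [steinVector, divergence_featureField hK, PiLp.inner_apply, PiLp.inner_apply,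
    ← Finset.sum_add_distrib]
  refine Finset.sum_congr rfl fun i _ => ?_
  simp [steinFeature, featureField, inner_add_right, inner_smul_right, mul_comm]

theorem gradient_left_apply (hK : ContDiff ℝ 1 K) (hkK : ∀ x y, k x y = inner ℝ (K x) (K y))
    (x y : Space d) (i : Fin d) :
    gradient (fun x' => k x' y) x i
      = inner ℝ (fderiv ℝ K x (EuclideanSpace.single i 1)) (K y) := by
  have h : HasFDerivAt (fun x' => k x' y) ((innerSL ℝ (K y)).comp (fderiv ℝ K x)) x := by
    have hfun : (fun x' => k x' y) = fun x' => inner ℝ (K y) (K x') :=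
      funext fun x' => by rw [hkK, real_inner_comm]
    rw [hfun]
    exact (innerSL ℝ (K y)).hasFDerivAt.comp x (hK.differentiable (by norm_num) x).hasFDerivAt
  rw [gradient_apply, h.fderiv]
  simp [real_inner_comm]

theorem gradient_right_apply (hK : ContDiff ℝ 1 K) (hkK : ∀ x y, k x y = inner ℝ (K x) (K y))
    (x y : Space d) (i : Fin d) :
    gradient (fun y' => k x y') y i
      = inner ℝ (K x) (fderiv ℝ K y (EuclideanSpace.single i 1)) := by
  rw [gradient_left_apply (k := fun a b => k b a) hK (fun a b => by rw [hkK, real_inner_comm]),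
    real_inner_comm]

theorem steinScalar_eq (hK : ContDiff ℝ 1 K) (hkK : ∀ x y, k x y = inner ℝ (K x) (K y))
    (x y : Space d) :
    steinScalar ρ (fun x' => k x' y) x = featureField K (steinFeature ρ K x) y := by
  ext i
  rw [steinScalar, PiLp.add_apply, PiLp.smul_apply, gradient_left_apply hK hkK, hkK]
  simp [featureField, steinFeature, inner_add_left, inner_smul_left, mul_comm]

/-- The Stein kernel is the reproducing kernel of the Stein feature map. -/
theorem steinKernel_eq_inner (hK : ContDiff ℝ 1 K) (hkK : ∀ x y, k x y = inner ℝ (K x) (K y))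
    (x y : Space d) :
    steinKernel ρ k x y = inner ℝ (steinFeature ρ K x) (steinFeature ρ K y) := by
  rw [steinKernel, ← steinVector_featureField hK]
  simp_rw [steinScalar_eq hK hkK]

theorem sqrt_steinKernel_self (hK : ContDiff ℝ 1 K) (hkK : ∀ x y, k x y = inner ℝ (K x) (K y))
    (x : Space d) : √(steinKernel ρ k x x) = ‖steinFeature ρ K x‖ := by
  rw [steinKernel_eq_inner hK hkK, real_inner_self_eq_norm_sq, Real.sqrt_sq (norm_nonneg _)]

/-- The explicit form of the Stein kernel. -/
theorem steinKernel_eq (hK : ContDiff ℝ 1 K) (hkK : ∀ x y, k x y = inner ℝ (K x) (K y))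
    (x y : Space d) :
    steinKernel ρ k x y = k x y * inner ℝ (score ρ x) (score ρ y)
        + inner ℝ (score ρ x) (gradient (fun y' => k x y') y)
        + inner ℝ (score ρ y) (gradient (fun x' => k x' y) x)
        + divergence (fun x' => gradient (fun y' => k x' y') y) x := by
  have hdiv : (fun x' => gradient (fun y' => k x' y') y) = featureField K
      (WithLp.toLp 2 fun i => fderiv ℝ K y (EuclideanSpace.single i 1)) := by
    funext x'
    ext i
    rw [gradient_right_apply hK hkK, real_inner_comm]
    rfl
  rw [steinKernel_eq_inner hK hkK, hdiv, divergence_featureField hK]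
  simp only [PiLp.inner_apply, Finset.mul_sum, ← Finset.sum_add_distrib]
  refine Finset.sum_congr rfl fun i _ => ?_
  simp only [gradient_left_apply hK hkK, gradient_right_apply hK hkK]
  simp only [steinFeature, inner_add_left, inner_add_right, inner_smul_left, inner_smul_right, hkK,
    RCLike.inner_apply]
  rw [real_inner_comm (fderiv ℝ K x _) (fderiv ℝ K y _)]
  simp
  ring

end SteinFeature

/-! ### The mean field and the discrepancy through the mean Stein feature. -/

section MeanFeature

variable {d : ℕ} {H : Type*} [NormedAddCommGroup H] [InnerProductSpace ℝ H]

/-- The `w`-weighted mean of the Stein feature. -/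
def meanFeature (p ρ : Space d → ℝ) (K : Space d → H) (μ : Measure (Space d)) :
    PiLp 2 (fun _ : Fin d => H) :=
  ∫ x, weight p ρ x • steinFeature ρ K x ∂μ

variable {p ρ : Space d → ℝ} {k : Space d → Space d → ℝ} {K : Space d → H}

theorem weight_pos (hp_pos : ∀ x, 0 < p x) (hρ_pos : ∀ x, 0 < ρ x) (x : Space d) :
    0 < weight p ρ x := div_pos (hρ_pos x) (hp_pos x)

theorem contDiff_weight (hp : ContDiff ℝ 1 p) (hp_pos : ∀ x, 0 < p x) (hρ : ContDiff ℝ 1 ρ) :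
    ContDiff ℝ 1 (weight p ρ) := hρ.div hp fun x => (hp_pos x).ne'

theorem continuous_weight_smul_steinFeature (hp : ContDiff ℝ 1 p) (hp_pos : ∀ x, 0 < p x)
    (hρ : ContDiff ℝ 1 ρ) (hρ_pos : ∀ x, 0 < ρ x) (hK : ContDiff ℝ 1 K) :
    Continuous fun x => weight p ρ x • steinFeature ρ K x :=
  (contDiff_weight hp hp_pos hρ).continuous.smul (continuous_steinFeature hρ hρ_pos hK)

/-- This translates the moment assumption on `w √κ_ρ` into norm integrability of the weighted Stein
feature. -/
theorem norm_weight_smul_steinFeature (hp_pos : ∀ x, 0 < p x) (hρ_pos : ∀ x, 0 < ρ x)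
    (hK : ContDiff ℝ 1 K) (hkK : ∀ x y, k x y = inner ℝ (K x) (K y)) (x : Space d) :
    ‖weight p ρ x • steinFeature ρ K x‖ = weight p ρ x * √(steinKernel ρ k x x) := by
  rw [norm_smul, sqrt_steinKernel_self hK hkK, Real.norm_of_nonneg (weight_pos hp_pos hρ_pos x).le]

theorem drift_eq (hK : ContDiff ℝ 1 K) (hkK : ∀ x y, k x y = inner ℝ (K x) (K y))
    (x y : Space d) :
    drift p ρ k x y = featureField K (weight p ρ x • steinFeature ρ K x) y := by
  rw [drift, steinScalar_eq hK hkK]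
  ext i
  simp [featureField, inner_smul_left]

/-- The evaluation at `y` of the field represented by a tuple, as a continuous linear map. -/
def featureFieldCLM (K : Space d → H) (y : Space d) :
    PiLp 2 (fun _ : Fin d => H) →L[ℝ] Space d :=
  LinearMap.mkContinuous
    { toFun := fun M => featureField K M y
      map_add' := fun M N => by ext i; simp [featureField, inner_add_left]
      map_smul' := fun c M => by ext i; simp [featureField, inner_smul_left] }
    ‖K y‖ fun M => by
      rw [mul_comm]
      exact norm_featureField_le M y

theorem integrable_drift (hK : ContDiff ℝ 1 K) (hkK : ∀ x y, k x y = inner ℝ (K x) (K y))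
    {μ : Measure (Space d)} (hμ : Integrable (fun x => weight p ρ x • steinFeature ρ K x) μ)
    (y : Space d) : Integrable (fun x => drift p ρ k x y) μ := by
  simp_rw [drift_eq hK hkK]
  exact (featureFieldCLM K y).integrable_comp hμ

/-- By Cauchy–Schwarz the integrand is dominated by a product of norms, so a first moment of `w
√κ_ρ` suffices. -/
theorem integrable_steinKernel_prod (hK : ContDiff ℝ 1 K)
    (hkK : ∀ x y, k x y = inner ℝ (K x) (K y)) {μ : Measure (Space d)} [SFinite μ]
    (hμ : Integrable (fun x => weight p ρ x • steinFeature ρ K x) μ) :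
    Integrable (fun z : Space d × Space d =>
      weight p ρ z.1 * weight p ρ z.2 * steinKernel ρ k z.1 z.2) (μ.prod μ) := by
  have h : (fun z : Space d × Space d =>
      weight p ρ z.1 * weight p ρ z.2 * steinKernel ρ k z.1 z.2) =
      fun z => inner ℝ (weight p ρ z.1 • steinFeature ρ K z.1)
        (weight p ρ z.2 • steinFeature ρ K z.2) := by
    funext z
    rw [steinKernel_eq_inner hK hkK, inner_smul_left, inner_smul_right]
    simp [mul_assoc]
  rw [h]
  refine (hμ.norm.mul_prod hμ.norm).mono' ?_ (ae_of_all _ fun z => norm_inner_le_norm _ _)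
  exact hμ.1.comp_fst.inner hμ.1.comp_snd

variable [CompleteSpace H]

/-- The mean field is the field represented by the mean Stein feature. -/
theorem meanField_eq (hK : ContDiff ℝ 1 K) (hkK : ∀ x y, k x y = inner ℝ (K x) (K y))
    {μ : Measure (Space d)} (hμ : Integrable (fun x => weight p ρ x • steinFeature ρ K x) μ) :
    meanField p ρ k μ = featureField K (meanFeature p ρ K μ) := by
  funext y
  rw [meanField]
  simp_rw [drift_eq hK hkK]
  exact (featureFieldCLM K y).integral_comp_comm hμ

theorem integral_weight_mul_inner {μ : Measure (Space d)}
    (hμ : Integrable (fun x => weight p ρ x • steinFeature ρ K x) μ)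
    (M : PiLp 2 (fun _ : Fin d => H)) :
    ∫ x, weight p ρ x * inner ℝ M (steinFeature ρ K x) ∂μ = inner ℝ M (meanFeature p ρ K μ) := by
  rw [meanFeature, ← integral_inner hμ M]
  simp_rw [inner_smul_right]

/-- The kernel Stein discrepancy is the squared norm of the mean Stein feature. -/
theorem integral_steinKernel_prod (hK : ContDiff ℝ 1 K)
    (hkK : ∀ x y, k x y = inner ℝ (K x) (K y)) {μ : Measure (Space d)} [SFinite μ]
    (hμ : Integrable (fun x => weight p ρ x • steinFeature ρ K x) μ) :
    ∫ z : Space d × Space d, weight p ρ z.1 * weight p ρ z.2 * steinKernel ρ k z.1 z.2 ∂(μ.prod μ)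
      = ‖meanFeature p ρ K μ‖ ^ 2 := by
  rw [integral_prod _ (integrable_steinKernel_prod hK hkK hμ)]
  simp_rw [mul_assoc, integral_const_mul, steinKernel_eq_inner hK hkK,
    integral_weight_mul_inner hμ, real_inner_comm (meanFeature p ρ K μ)]
  rw [integral_weight_mul_inner hμ, real_inner_self_eq_norm_sq]

end MeanFeature

/-! ### Integrals against densities and time regularity of the density. -/

section DensityMeasure

variable {d : ℕ} {f : Space d → ℝ} {E : Type*} [NormedAddCommGroup E] [NormedSpace ℝ E]

theorem integral_densityMeasure (hf : Measurable f) (hf0 : ∀ x, 0 ≤ f x) (g : Space d → E) :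
    ∫ x, g x ∂(densityMeasure f) = ∫ x, f x • g x := by
  rw [densityMeasure, integral_withDensity_eq_integral_toReal_smul hf.ennreal_ofReal
    (ae_of_all _ fun _ => ENNReal.ofReal_lt_top)]
  simp_rw [ENNReal.toReal_ofReal (hf0 _)]

theorem integrable_densityMeasure_iff (hf : Measurable f) (hf0 : ∀ x, 0 ≤ f x)
    {g : Space d → E} :
    Integrable g (densityMeasure f) ↔ Integrable fun x => f x • g x := by
  rw [densityMeasure, integrable_withDensity_iff_integrable_smul₀' hf.ennreal_ofReal.aemeasurable
    (ae_of_all _ fun _ => ENNReal.ofReal_lt_top)]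
  simp_rw [ENNReal.toReal_ofReal (hf0 _)]

end DensityMeasure

/-- Differentiation under the integral sign, within a set of parameters. -/
theorem hasDerivWithinAt_integral_of_dominated_sub_le {α : Type*} [MeasurableSpace α]
    {μ : Measure α} {F : ℝ → α → ℝ} {F' bound : α → ℝ} {I : Set ℝ} {t : ℝ} (ht : t ∈ I)
    (hF : ∀ s ∈ I, Integrable (F s) μ) (hbound : Integrable bound μ)
    (hle : ∀ᶠ s in 𝓝[I] t, ∀ᵐ a ∂μ, |F s a - F t a| ≤ bound a * |s - t|)
    (hderiv : ∀ᵐ a ∂μ, HasDerivWithinAt (fun s => F s a) (F' a) I t) :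
    HasDerivWithinAt (fun s => ∫ a, F s a ∂μ) (∫ a, F' a ∂μ) I t := by
  rw [hasDerivWithinAt_iff_tendsto_slope]
  have hmono : 𝓝[I \ {t}] t ≤ 𝓝[I] t := nhdsWithin_mono _ sdiff_subset
  have hI : ∀ᶠ s in 𝓝[I \ {t}] t, s ∈ I \ {t} := self_mem_nhdsWithin
  have key : Tendsto (fun s => ∫ a, slope (fun r => F r a) t s ∂μ) (𝓝[I \ {t}] t)
      (𝓝 (∫ a, F' a ∂μ)) := by
    refine tendsto_integral_filter_of_dominated_convergence bound ?_ ?_ hbound ?_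
    · filter_upwards [hI] with s hs
      simp only [slope_def_field]
      exact (((hF s hs.1).sub (hF t ht)).div_const (s - t)).1
    · filter_upwards [hI, hmono hle] with s hs hle
      filter_upwards [hle] with a ha
      have : 0 < |s - t| := abs_pos.2 (sub_ne_zero.2 hs.2)
      rw [slope_def_field, Real.norm_eq_abs, abs_div, div_le_iff₀ this]
      exact ha
    · filter_upwards [hderiv] with a ha
      exact hasDerivWithinAt_iff_tendsto_slope.1 ha
  refine key.congr' ?_
  filter_upwards [hI] with s hs
  simp only [slope_def_field]
  rw [integral_div, integral_sub (hF s hs.1) (hF t ht)]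

/-- Uniqueness of derivatives within `I`, end points included, allows two computations of one time
derivative to be equated. -/
theorem uniqueDiffOn_of_ordConnected {I : Set ℝ} (hI : I.OrdConnected) (hne : I.Nontrivial) :
    UniqueDiffOn ℝ I := by
  obtain ⟨a, ha, b, hb, hab⟩ := hne.exists_lt
  refine uniqueDiffOn_convex hI.convex ?_
  refine (nonempty_Ioo.2 hab).mono ?_
  exact interior_maximal (Ioo_subset_Icc_self.trans (hI.out ha hb)) isOpen_Ioo

section Density

variable {d : ℕ} {I : Set ℝ} {q : ℝ → Space d → ℝ}

theorem contDiff_density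
    (hq : ContDiffOn ℝ 1 (fun z : ℝ × Space d => q z.1 z.2) (I ×ˢ univ)) {t : ℝ} (ht : t ∈ I) :
    ContDiff ℝ 1 (q t) := by
  rw [← contDiffOn_univ]
  exact hq.comp (f := fun x => (t, x)) (by fun_prop) fun x _ => ⟨ht, mem_univ x⟩

theorem hasDerivWithinAt_density
    (hq : ContDiffOn ℝ 1 (fun z : ℝ × Space d => q z.1 z.2) (I ×ˢ univ)) {t : ℝ} (ht : t ∈ I)
    (y : Space d) :
    HasDerivWithinAt (fun s => q s y)
      (fderivWithin ℝ (fun z : ℝ × Space d => q z.1 z.2) (I ×ˢ univ) (t, y) (1, 0)) I t := by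
  have h := (hq.differentiableOn (by norm_num) (t, y) ⟨ht, mem_univ y⟩).hasFDerivWithinAt
  exact h.comp_hasDerivWithinAt (f := fun s => (s, y)) t
    ((hasDerivWithinAt_id t I).prodMk (hasDerivWithinAt_const t I y))
    fun s hs => ⟨hs, mem_univ y⟩

/-- A C¹ function on a convex set is locally Lipschitz; compactness merges the local constants. The
result dominates the time slopes of `q` on the support of a test function. -/
theorem exists_density_sub_le
    (hq : ContDiffOn ℝ 1 (fun z : ℝ × Space d => q z.1 z.2) (I ×ˢ univ))
    (hI : I.OrdConnected) {t : ℝ} (ht : t ∈ I) {C : Set (Space d)} (hC : IsCompact C) :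
    ∃ M, 0 ≤ M ∧ ∀ᶠ s in 𝓝[I] t, ∀ x ∈ C, |q s x - q t x| ≤ M * |s - t| := by
  refine hC.induction_on (p := fun S => ∃ M, 0 ≤ M ∧
    ∀ᶠ s in 𝓝[I] t, ∀ x ∈ S, |q s x - q t x| ≤ M * |s - t|) ⟨0, le_rfl, by simp⟩ ?_ ?_ ?_
  · rintro S T hST ⟨M, hM, h⟩
    exact ⟨M, hM, h.mono fun s hs x hx => hs x (hST hx)⟩
  · rintro S T ⟨M, hM, h⟩ ⟨N, hN, h'⟩
    refine ⟨max M N, le_max_of_le_left hM, ?_⟩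
    filter_upwards [h, h'] with s hs hs' x hx
    rcases hx with hx | hx
    · exact (hs x hx).trans (by gcongr; exact le_max_left _ _)
    · exact (hs' x hx).trans (by gcongr; exact le_max_right _ _)
  · intro x _
    obtain ⟨M, N, hN, hL⟩ := (hq (t, x) ⟨ht, mem_univ x⟩).exists_lipschitzOnWith
      (hI.convex.prod convex_univ)
    rw [nhdsWithin_prod_eq, nhdsWithin_univ, mem_prod_iff] at hN
    obtain ⟨U, hU, V, hV, hUV⟩ := hN
    refine ⟨V, mem_nhdsWithin_of_mem_nhds hV, M, M.2, ?_⟩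
    filter_upwards [hU] with s hs y hy
    have := hL.norm_sub_le (hUV (mk_mem_prod hs hy)) (hUV (mk_mem_prod (mem_of_mem_nhdsWithin ht hU) hy))
    simpa [Prod.norm_def] using this

theorem continuous_fderivWithin_density
    (hq : ContDiffOn ℝ 1 (fun z : ℝ × Space d => q z.1 z.2) (I ×ˢ univ))
    (hI : I.OrdConnected) (hne : I.Nontrivial) {t : ℝ} (ht : t ∈ I) :
    Continuous fun y => fderivWithin ℝ (fun z : ℝ × Space d => q z.1 z.2) (I ×ˢ univ) (t, y) := by
  have h := hq.continuousOn_fderivWithin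
    ((uniqueDiffOn_of_ordConnected hI hne).prod uniqueDiffOn_univ) le_rfl
  rw [← continuousOn_univ]
  exact h.comp (by fun_prop) fun x _ => ⟨ht, mem_univ x⟩

end Density

/-! ### The continuity equation, from weak to pointwise form. -/

section ContinuityEquation

variable {d : ℕ}

theorem continuous_divergence {F : Space d → Space d} (hF : ContDiff ℝ 1 F) :
    Continuous (divergence F) := by
  have := hF.continuous_fderiv (by norm_num)
  unfold divergence
  fun_prop

/-- Integration by parts against a compactly supported test function. -/
theorem integral_fderiv_apply_eq_neg {F : Space d → Space d} (hF : ContDiff ℝ 1 F)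
    {ψ : Space d → ℝ} (hψ : ContDiff ℝ 1 ψ) (hc : HasCompactSupport ψ) :
    ∫ x, fderiv ℝ ψ x (F x) = -∫ x, ψ x * divergence F x := by
  have hFi : ∀ i, ContDiff ℝ 1 fun x => F x i := contDiff_euclidean.1 hF
  have hcF := hF.continuous
  have hcF' := hF.continuous_fderiv (by norm_num)
  have hcψ := hψ.continuous
  have hcψ' := hψ.continuous_fderiv (by norm_num)
  have hFi' : ∀ i x, fderiv ℝ (fun x => F x i) x (EuclideanSpace.single i 1)
      = (fderiv ℝ F x (EuclideanSpace.single i 1)) i := by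
    intro i x
    have h2 := (EuclideanSpace.proj i : Space d →L[ℝ] ℝ).hasFDerivAt.comp x
      (hF.differentiable (by norm_num) x).hasFDerivAt
    exact congrArg (fun L => L (EuclideanSpace.single i 1)) h2.fderiv
  have hi1 : ∀ i, Integrable fun x => F x i * fderiv ℝ ψ x (EuclideanSpace.single i 1) := by
    intro i
    refine Continuous.integrable_of_hasCompactSupport (by fun_prop) ?_
    exact (hc.fderiv_apply (𝕜 := ℝ) _).mul_left
  have hi2 : ∀ i, Integrable fun x =>
      (fderiv ℝ F x (EuclideanSpace.single i 1)) i * ψ x := by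
    intro i
    exact Continuous.integrable_of_hasCompactSupport (by fun_prop) hc.mul_left
  have hi3 : ∀ i, Integrable fun x => F x i * ψ x := by
    intro i
    exact Continuous.integrable_of_hasCompactSupport (by fun_prop) hc.mul_left
  have key : ∀ i, ∫ x, F x i * fderiv ℝ ψ x (EuclideanSpace.single i 1)
      = -∫ x, (fderiv ℝ F x (EuclideanSpace.single i 1)) i * ψ x := by
    intro i
    have := integral_mul_fderiv_eq_neg_fderiv_mul_of_integrable (μ := volume)
      (f := fun x => F x i) (g := ψ) (v := EuclideanSpace.single i 1)
      (by simpa only [hFi'] using hi2 i) (hi1 i) (hi3 i)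
      (fun x _ => (hFi i).differentiable (by norm_num) x)
      (fun x _ => hψ.differentiable (by norm_num) x)
    simpa only [hFi'] using this
  have hexp : ∀ x, fderiv ℝ ψ x (F x)
      = ∑ i, F x i * fderiv ℝ ψ x (EuclideanSpace.single i 1) := by
    intro x
    have : F x = ∑ i, F x i • (EuclideanSpace.single i (1 : ℝ)) := by
      ext j
      simp [Finset.sum_apply, Pi.single_apply]
    conv_lhs => rw [this]
    simp
  simp_rw [hexp, divergence, Finset.mul_sum]
  rw [integral_finsetSum _ fun i _ => hi1 i, integral_finsetSum _ fun i _ => by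
    simpa only [mul_comm] using hi2 i, ← Finset.sum_neg_distrib]
  exact Finset.sum_congr rfl fun i _ => by rw [key]; simp_rw [mul_comm]

variable {Ω : Type*} [MeasurableSpace Ω] {P : Measure Ω} [IsProbabilityMeasure P]
  {I : Set ℝ} {X : ℝ → Ω → Space d} {q : ℝ → Space d → ℝ} {v : ℝ → Space d → Space d}

/-- The weak form of the evolution of the law along a flow. -/
theorem hasDerivWithinAt_integral_comp_flow (hI : I.OrdConnected)
    (hX : ∀ t ∈ I, AEMeasurable (X t) P)
    (hode : ∀ᵐ ω ∂P, ∀ t ∈ I, HasDerivWithinAt (fun s => X s ω) (v t (X t ω)) I t)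
    {t : ℝ} (ht : t ∈ I)
    (hv : ∀ C : Set (Space d), IsCompact C → ∃ M, ∀ᶠ s in 𝓝[I] t, ∀ y ∈ C, ‖v s y‖ ≤ M)
    {ψ : Space d → ℝ} (hψ : ContDiff ℝ 1 ψ) (hc : HasCompactSupport ψ) :
    HasDerivWithinAt (fun s => ∫ ω, ψ (X s ω) ∂P)
      (∫ ω, fderiv ℝ ψ (X t ω) (v t (X t ω)) ∂P) I t := by
  obtain ⟨M, hM⟩ := hv _ hc.isCompact
  have hcψ' := hψ.continuous_fderiv (by norm_num)
  obtain ⟨L, hL⟩ := hcψ'.bounded_above_of_compact_support (hc.fderiv (𝕜 := ℝ))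
  obtain ⟨N, hN⟩ := hψ.continuous.bounded_above_of_compact_support hc
  have hL0 : 0 ≤ L := (norm_nonneg _).trans (hL 0)
  obtain ⟨δ, hδ, hball⟩ := Metric.mem_nhdsWithin_iff.1 hM
  -- `max M 0` is used because `M` may be negative when the support is empty.
  refine hasDerivWithinAt_integral_of_dominated_sub_le (bound := fun _ => L * max M 0) ht
    (fun s hs => Integrable.of_bound
      (hψ.continuous.measurable.comp_aemeasurable (hX s hs)).aestronglyMeasurable N
      (ae_of_all _ fun ω => hN _)) (integrable_const _) ?_ ?_
  · have hmem : Metric.ball t δ ∩ I ∈ 𝓝[I] t :=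
      inter_mem (mem_nhdsWithin_of_mem_nhds (Metric.ball_mem_nhds t hδ)) self_mem_nhdsWithin
    filter_upwards [hmem] with s hs
    filter_upwards [hode] with ω hω
    have hder : ∀ r ∈ Metric.ball t δ ∩ I, HasDerivWithinAt (fun r => ψ (X r ω))
        (fderiv ℝ ψ (X r ω) (v r (X r ω))) (Metric.ball t δ ∩ I) r := fun r hr =>
      ((hψ.differentiable (by norm_num) (X r ω)).hasFDerivAt.comp_hasDerivWithinAt r
        (hω r hr.2)).mono inter_subset_right
    refine Convex.norm_image_sub_le_of_norm_hasDerivWithin_le hder (fun r hr => ?_)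
      ((convex_ball t δ).inter hI.convex) ⟨Metric.mem_ball_self hδ, ht⟩ hs
    -- Off the support of `ψ` its derivative vanishes, so the velocity needs a bound only on that
    -- compact set.
    by_cases hmem : X r ω ∈ tsupport ψ
    · refine (ContinuousLinearMap.le_opNorm _ _).trans ?_
      exact mul_le_mul (hL _) ((hball hr _ hmem).trans (le_max_left _ _)) (norm_nonneg _) hL0
    · have : fderiv ℝ ψ (X r ω) = 0 := by
        by_contra hne
        exact hmem (support_fderiv_subset ℝ hne)
      rw [this, zero_apply, norm_zero]
      positivity
  · filter_upwards [hode] with ω hω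
    exact (hψ.differentiable (by norm_num) (X t ω)).hasFDerivAt.comp_hasDerivWithinAt t (hω t ht)

/-- The continuity equation for the density of a flow. -/
theorem continuity_equation (hI : I.OrdConnected)
    (hq0 : ∀ t ∈ I, ∀ x, 0 ≤ q t x)
    (hq : ContDiffOn ℝ 1 (fun z : ℝ × Space d => q z.1 z.2) (I ×ˢ univ))
    (hX : ∀ t ∈ I, HasLaw (X t) (densityMeasure (q t)) P)
    (hode : ∀ᵐ ω ∂P, ∀ t ∈ I, HasDerivWithinAt (fun s => X s ω) (v t (X t ω)) I t)
    {t : ℝ} (ht : t ∈ I) (hvt : ContDiff ℝ 1 (v t))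
    (hv : ∀ C : Set (Space d), IsCompact C → ∃ M, ∀ᶠ s in 𝓝[I] t, ∀ y ∈ C, ‖v s y‖ ≤ M)
    (y : Space d) :
    HasDerivWithinAt (fun s => q s y) (-divergence (fun z => q t z • v t z) y) I t := by
  -- Within a one-point interval every value is a derivative.
  rcases I.subsingleton_or_nontrivial with hsub | hne
  · exact hasDerivWithinAt_iff_hasFDerivWithinAt.2 (.of_subsingleton hsub)
  have hqt := contDiff_density hq ht
  have hF : ContDiff ℝ 1 fun z => q t z • v t z := hqt.smul hvt
  set qdot : Space d → ℝ := fun y =>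
    fderivWithin ℝ (fun z : ℝ × Space d => q z.1 z.2) (I ×ˢ univ) (t, y) (1, 0) with hqdot
  have hqdot_cont : Continuous qdot :=
    (continuous_fderivWithin_density hq hI hne ht).clm_apply continuous_const
  have hdiv_cont := continuous_divergence hF
  have hweak : ∀ ψ : Space d → ℝ, ContDiff ℝ 1 ψ → HasCompactSupport ψ →
      ∫ x, ψ x * qdot x = -∫ x, ψ x * divergence (fun z => q t z • v t z) x := by
    intro ψ hψ hc
    have hcψ' := hψ.continuous_fderiv (by norm_num)
    have hcψ := hψ.continuous
    rw [← integral_fderiv_apply_eq_neg hF hψ hc]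
    have h1 := hasDerivWithinAt_integral_comp_flow hI (fun s hs => (hX s hs).aemeasurable)
      hode ht hv hψ hc
    obtain ⟨M, hM0, hM⟩ := exists_density_sub_le hq hI ht hc.isCompact
    have h2 : HasDerivWithinAt (fun s => ∫ x, ψ x * q s x) (∫ x, ψ x * qdot x) I t := by
      refine hasDerivWithinAt_integral_of_dominated_sub_le (bound := fun x => |ψ x| * M) ht
        (fun s hs => ?_) ?_ ?_ (ae_of_all _ fun x => (hasDerivWithinAt_density hq ht x).const_mul _)
      · have := (contDiff_density hq hs).continuous
        exact Continuous.integrable_of_hasCompactSupport (by fun_prop) hc.mul_right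
      · exact Continuous.integrable_of_hasCompactSupport (by fun_prop)
          (hc.comp_left (g := fun r => |r| * M) (by simp))
      · filter_upwards [hM] with s hs
        refine ae_of_all _ fun x => ?_
        rw [← mul_sub, abs_mul, mul_assoc]
        by_cases hx : x ∈ tsupport ψ
        · exact mul_le_mul_of_nonneg_left (hs x hx) (abs_nonneg _)
        · simp [image_eq_zero_of_notMem_tsupport hx]
    have h3 : ∀ s ∈ I, ∫ ω, ψ (X s ω) ∂P = ∫ x, ψ x * q s x := by
      intro s hs
      have := (hX s hs).integral_comp hψ.continuous.aestronglyMeasurable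
      simp only [Function.comp_def] at this
      rw [this, integral_densityMeasure (contDiff_density hq hs).continuous.measurable (hq0 s hs)]
      simp_rw [smul_eq_mul, mul_comm]
    have h4 : ∫ ω, fderiv ℝ ψ (X t ω) (v t (X t ω)) ∂P
        = ∫ x, fderiv ℝ ψ x (q t x • v t x) := by
      have hcont : Continuous fun x => fderiv ℝ ψ x (v t x) := hcψ'.clm_apply hvt.continuous
      have := (hX t ht).integral_comp hcont.aestronglyMeasurable
      simp only [Function.comp_def] at this
      rw [this, integral_densityMeasure hqt.continuous.measurable (hq0 t ht)]
      simp_rw [map_smul]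
    rw [← h4]
    have h2' := h2.congr_of_mem (fun s hs => h3 s hs) ht
    exact (uniqueDiffOn_of_ordConnected hI hne t ht).eq_deriv _ h2' h1
  -- The defect is orthogonal to all test functions, hence zero almost everywhere, hence everywhere
  -- by continuity.
  have hae := ae_eq_zero_of_integral_contDiff_smul_eq_zero (μ := volume)
    (f := fun x => qdot x + divergence (fun z => q t z • v t z) x)
    (hqdot_cont.add hdiv_cont).locallyIntegrable fun ψ hψ hc => by
      have hψ1 : ContDiff ℝ 1 ψ := hψ.of_le (by exact_mod_cast le_top)
      have hcψ := hψ1.continuous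
      simp only [smul_eq_mul, mul_add]
      rw [integral_add, hweak ψ hψ1 hc, neg_add_cancel]
      · exact Continuous.integrable_of_hasCompactSupport (by fun_prop) hc.mul_right
      · exact Continuous.integrable_of_hasCompactSupport (by fun_prop) hc.mul_right
  have heq := (hqdot_cont.add hdiv_cont).ae_eq_iff_eq volume continuous_const |>.1 hae
  have hy : qdot y = -divergence (fun z => q t z • v t z) y :=
    eq_neg_of_add_eq_zero_left (congrFun heq y)
  rw [← hy]
  exact hasDerivWithinAt_density hq ht y

end ContinuityEquation

/-! ### Tools: calculus on an interval, Scheffé's lemma, joint measurability. -/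

/-- The fundamental theorem of calculus within an order-connected set. -/
theorem hasDerivWithinAt_intervalIntegral_of_continuousOn {I : Set ℝ} (hI : I.OrdConnected)
    {f : ℝ → ℝ} (hf : ContinuousOn f I) {a t : ℝ} (ha : a ∈ I) (ht : t ∈ I) :
    HasDerivWithinAt (fun s => ∫ r in a..s, f r) (f t) I t := by
  have hint : ∀ x ∈ I, ∀ y ∈ I, IntervalIntegrable f volume x y := fun x hx y hy =>
    (hf.mono (hI.uIcc_subset hx hy)).intervalIntegrable
  rw [hasDerivWithinAt_iff_isLittleO, Asymptotics.isLittleO_iff]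
  intro ε hε
  obtain ⟨δ, hδ, hb⟩ := Metric.continuousWithinAt_iff.1 (hf t ht) ε hε
  have hmem : Metric.ball t δ ∩ I ∈ 𝓝[I] t :=
    inter_mem (mem_nhdsWithin_of_mem_nhds (Metric.ball_mem_nhds t hδ)) self_mem_nhdsWithin
  filter_upwards [hmem] with s hs
  have heq : (∫ r in a..s, f r) - (∫ r in a..t, f r) - (s - t) • f t
      = ∫ r in t..s, (f r - f t) := by
    rw [intervalIntegral.integral_interval_sub_left (hint a ha s hs.2) (hint a ha t ht),
      intervalIntegral.integral_sub (hint t ht s hs.2) intervalIntegrable_const,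
      intervalIntegral.integral_const]
  rw [heq, Real.norm_eq_abs (s - t)]
  refine intervalIntegral.norm_integral_le_of_norm_le_const fun r hr => ?_
  have hr' := uIoc_subset_uIcc hr
  have hrt : dist r t ≤ dist s t := by
    rw [dist_comm r, dist_comm s]
    exact Real.dist_left_le_of_mem_uIcc hr'
  rw [← dist_eq_norm]
  exact (hb (hI.uIcc_subset ht hs.2 hr') (hrt.trans_lt hs.1)).le

/-- **Scheffé's lemma**, along a countably generated filter. -/
theorem tendsto_integral_abs_sub_of_tendsto_integral {α ι : Type*} [MeasurableSpace α]
    {μ : Measure α} {l : Filter ι} [l.IsCountablyGenerated] {F : ι → α → ℝ} {f : α → ℝ}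
    (hF : ∀ᶠ n in l, Integrable (F n) μ) (hF0 : ∀ᶠ n in l, ∀ x, 0 ≤ F n x)
    (hf : Integrable f μ) (hf0 : ∀ x, 0 ≤ f x)
    (hlim : ∀ x, Tendsto (fun n => F n x) l (𝓝 (f x)))
    (hint : Tendsto (fun n => ∫ x, F n x ∂μ) l (𝓝 (∫ x, f x ∂μ))) :
    Tendsto (fun n => ∫ x, |F n x - f x| ∂μ) l (𝓝 0) := by
  -- The part `(f - F)⁺` is dominated by `f`, and `|F - f| = (F - f) + 2 (f - F)⁺` reduces the claim
  -- to it.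
  have hpos : Tendsto (fun n => ∫ x, max (f x - F n x) 0 ∂μ) l (𝓝 (∫ _, (0 : ℝ) ∂μ)) := by
    refine tendsto_integral_filter_of_dominated_convergence f ?_ ?_ hf ?_
    · filter_upwards [hF] with n hn
      exact (hf.sub hn).pos_part.1
    · filter_upwards [hF0] with n hn
      refine ae_of_all _ fun x => ?_
      rw [Real.norm_of_nonneg (le_max_right _ _)]
      exact max_le (by linarith [hn x]) (hf0 x)
    · refine ae_of_all _ fun x => ?_
      have := ((tendsto_const_nhds (x := f x)).sub (hlim x)).max
        (tendsto_const_nhds (x := (0 : ℝ)))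
      simpa using this
  have h2 := (hint.sub_const (∫ x, f x ∂μ)).add (hpos.const_mul 2)
  rw [integral_zero, sub_self, mul_zero, add_zero] at h2
  refine h2.congr' ?_
  filter_upwards [hF] with n hn
  have hmax : Integrable (fun x => max (f x - F n x) 0) μ := (hf.sub hn).pos_part
  rw [← integral_sub hn hf, ← integral_const_mul, ← integral_add (f := fun x => F n x - f x) (hn.sub hf)
    (hmax.const_mul 2)]
  refine integral_congr_ae (ae_of_all _ fun x => ?_)
  simp only
  rcases le_total (F n x) (f x) with h | h
  · rw [max_eq_left (by linarith), abs_of_nonpos (by linarith)]; ring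
  · rw [max_eq_right (by linarith), abs_of_nonneg (by linarith)]; ring

/-- A process with almost surely continuous paths on a time set is jointly measurable. -/
theorem aemeasurable_uncurry_of_ae_continuousOn {Ω E : Type*} [MeasurableSpace Ω]
    {P : Measure Ω} [SFinite P] [TopologicalSpace E] [TopologicalSpace.PseudoMetrizableSpace E]
    [MeasurableSpace E] [BorelSpace E] {X : ℝ → Ω → E} {J : Set ℝ}
    (hX : ∀ t ∈ J, AEMeasurable (X t) P)
    (hc : ∀ᵐ ω ∂P, ContinuousOn (fun t => X t ω) J) {ν : Measure ℝ} [SFinite ν]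
    (hν : ∀ᵐ t ∂ν, t ∈ J) :
    AEMeasurable (fun z : ℝ × Ω => X z.1 z.2) (ν.prod P) := by
  rcases J.eq_empty_or_nonempty with rfl | ⟨t₀, ht₀⟩
  · have : ν = 0 := by simpa using hν
    simp [this]
  let X' : J → Ω → E := fun t => (hX t t.2).mk (X t)
  let r : ℕ → SimpleFunc ℝ ℝ := fun n => SimpleFunc.approxOn id measurable_id J t₀ ht₀ n
  have hr : ∀ n t, r n t ∈ J := fun n t => SimpleFunc.approxOn_mem measurable_id ht₀ n t
  classical
  -- The value outside `J` is never used: the discretised times `r n` stay in `J`.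
  let Y : ℝ → Ω → E := fun t ω => if h : t ∈ J then X' ⟨t, h⟩ ω else X' ⟨t₀, ht₀⟩ ω
  have hY : ∀ t, Measurable (Y t) := by
    intro t
    by_cases h : t ∈ J
    · simpa [Y, h] using (hX t h).measurable_mk
    · simpa [Y, h] using (hX t₀ ht₀).measurable_mk
  have hYX : ∀ t ∈ J, ∀ᵐ ω ∂P, X t ω = Y t ω := by
    intro t h
    filter_upwards [(hX t h).ae_eq_mk] with ω hω
    simpa [Y, h] using hω
  -- Only countably many discretised times occur, so a single null set handles all the measurable
  -- versions.
  have hall : ∀ᵐ ω ∂P, ∀ n, ∀ t ∈ (r n).range, X t ω = Y t ω := by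
    rw [ae_all_iff]
    intro n
    refine (ae_ball_iff (r n).range.countable_toSet).2 fun t ht => ?_
    obtain ⟨s, rfl⟩ := SimpleFunc.mem_range.1 (Finset.mem_coe.1 ht)
    exact hYX _ (hr n s)
  refine aemeasurable_of_tendsto_metrizable_ae atTop
    (f := fun n (z : ℝ × Ω) => Y (r n z.1) z.2) (fun n => ?_) ?_
  · exact (SimpleFunc.measurable_bind ((r n).comp Prod.fst measurable_fst)
      (fun t z => Y t z.2) fun t => (hY t).comp measurable_snd).aemeasurable
  · filter_upwards [Measure.quasiMeasurePreserving_snd.ae hall,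
      Measure.quasiMeasurePreserving_snd.ae hc, Measure.quasiMeasurePreserving_fst.ae hν]
      with z h1 h2 h3
    have hrz : Tendsto (fun n => r n z.1) atTop (𝓝[J] z.1) :=
      tendsto_nhdsWithin_iff.2 ⟨SimpleFunc.tendsto_approxOn measurable_id ht₀ (subset_closure h3),
        Eventually.of_forall fun n => hr n z.1⟩
    refine ((h2 z.1 h3).tendsto.comp hrz).congr fun n => ?_
    exact h1 n _ (SimpleFunc.mem_range_self _ _)

/-! ### Relative entropy of laws given by densities. -/

section KL

variable {d : ℕ} {f p : Space d → ℝ}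

theorem densityMeasure_eq_withDensity (hf : Measurable f) (hp : Measurable p)
    (hp_pos : ∀ x, 0 < p x) :
    densityMeasure f = (densityMeasure p).withDensity fun x => ENNReal.ofReal (f x / p x) := by
  have hfp : Measurable fun x => ENNReal.ofReal (f x / p x) := (hf.div hp).ennreal_ofReal
  rw [densityMeasure, densityMeasure, ← withDensity_mul _ hp.ennreal_ofReal hfp]
  congr 1
  funext x
  rw [Pi.mul_apply, ← ENNReal.ofReal_mul (hp_pos x).le, mul_div_cancel₀ _ (hp_pos x).ne']

theorem llr_densityMeasure (hf : Measurable f) (hf0 : ∀ x, 0 ≤ f x) (hp : Measurable p)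
    (hp_pos : ∀ x, 0 < p x) :
    llr (densityMeasure f) (densityMeasure p)
      =ᵐ[densityMeasure f] fun x => Real.log (f x / p x) := by
  have : SigmaFinite (densityMeasure p) :=
    SigmaFinite.withDensity_of_ne_top (ae_of_all _ fun _ => ENNReal.ofReal_ne_top)
  have h := Measure.rnDeriv_withDensity (densityMeasure p) (hf.div hp).ennreal_ofReal
  have hdm := densityMeasure_eq_withDensity hf hp hp_pos
  have hac : densityMeasure f ≪ densityMeasure p := by
    rw [hdm]; exact withDensity_absolutelyContinuous _ _
  refine hac.ae_le ?_
  rw [hdm]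
  filter_upwards [h] with x hx
  simp only [Pi.div_apply] at hx
  rw [llr_def]
  simp only [hx, ENNReal.toReal_ofReal (div_nonneg (hf0 x) (hp_pos x).le)]

theorem absolutelyContinuous_densityMeasure (hf : Measurable f) (hp : Measurable p)
    (hp_pos : ∀ x, 0 < p x) : densityMeasure f ≪ densityMeasure p := by
  rw [densityMeasure_eq_withDensity hf hp hp_pos]
  exact withDensity_absolutelyContinuous _ _

theorem isProbabilityMeasure_densityMeasure (hp_pos : ∀ x, 0 < p x)
    (hp_one : ∫ x, p x = 1) : IsProbabilityMeasure (densityMeasure p) := by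
  -- A non-integrable function has integral `0` by convention, so total integral `1` forces
  -- integrability.
  have hint : Integrable p := by
    by_contra h
    rw [integral_undef h] at hp_one
    exact zero_ne_one hp_one
  refine ⟨?_⟩
  rw [densityMeasure, withDensity_apply _ MeasurableSet.univ, Measure.restrict_univ,
    ← ofReal_integral_eq_lintegral_ofReal hint (ae_of_all _ fun x => (hp_pos x).le), hp_one,
    ENNReal.ofReal_one]

/-- The relative entropy of an absolutely continuous law is finite if and only if the logarithm
of the density ratio is integrable. -/
theorem klDiv_densityMeasure_ne_top_iff (hf : Measurable f) (hf0 : ∀ x, 0 ≤ f x)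
    (hp : Measurable p) (hp_pos : ∀ x, 0 < p x) :
    InformationTheory.klDiv (densityMeasure f) (densityMeasure p) ≠ ∞ ↔
      Integrable (fun x => Real.log (f x / p x)) (densityMeasure f) := by
  rw [InformationTheory.klDiv_ne_top_iff,
    and_iff_right (absolutelyContinuous_densityMeasure hf hp hp_pos),
    integrable_congr (llr_densityMeasure hf hf0 hp hp_pos)]

/-- Both masses equal one, so the mass correction in `klDiv` disappears. -/
theorem toReal_klDiv_densityMeasure (hf : Measurable f) (hf0 : ∀ x, 0 ≤ f x)
    (hp : Measurable p) (hp_pos : ∀ x, 0 < p x) [IsProbabilityMeasure (densityMeasure f)]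
    [IsProbabilityMeasure (densityMeasure p)] :
    (InformationTheory.klDiv (densityMeasure f) (densityMeasure p)).toReal
      = ∫ x, Real.log (f x / p x) ∂(densityMeasure f) := by
  rw [InformationTheory.toReal_klDiv_of_measure_eq
    (absolutelyContinuous_densityMeasure hf hp hp_pos) (by simp),
    integral_congr_ae (llr_densityMeasure hf hf0 hp hp_pos)]

end KL

/-! ### Continuity in time of the mean Stein feature. -/

section MeanFeature

variable {d : ℕ} {H : Type*} [NormedAddCommGroup H] [InnerProductSpace ℝ H]
  {p ρ : Space d → ℝ} {K : Space d → H} {I : Set ℝ} {q : ℝ → Space d → ℝ}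

/-- The mean Stein feature depends continuously on time. -/
theorem continuousOn_meanFeature
    (hq0 : ∀ t ∈ I, ∀ x, 0 ≤ q t x)
    (hq : ContDiffOn ℝ 1 (fun z : ℝ × Space d => q z.1 z.2) (I ×ˢ univ))
    (hint : ∀ t ∈ I, Integrable (fun x => weight p ρ x • steinFeature ρ K x)
      (densityMeasure (q t)))
    (hcont : ContinuousOn (fun t => ∫ x, ‖weight p ρ x • steinFeature ρ K x‖
      ∂(densityMeasure (q t))) I) :
    ContinuousOn (fun t => meanFeature p ρ K (densityMeasure (q t))) I := by
  intro t ht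
  set ξ := fun x => weight p ρ x • steinFeature ρ K x with hξ
  have hI : ∀ᶠ s in 𝓝[I] t, s ∈ I := self_mem_nhdsWithin
  have hmeas : ∀ s ∈ I, Measurable (q s) := fun s hs =>
    (contDiff_density hq hs).continuous.measurable
  have hint' : ∀ s ∈ I, Integrable fun x => q s x • ξ x := fun s hs =>
    (integrable_densityMeasure_iff (hmeas s hs) (hq0 s hs)).1 (hint s hs)
  have hintn : ∀ s ∈ I, Integrable fun x => q s x * ‖ξ x‖ := fun s hs =>
    (integrable_densityMeasure_iff (hmeas s hs) (hq0 s hs)).1 (hint s hs).norm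
  -- `‖m_s - m_t‖` is at most `∫ |q_s - q_t| ‖w Φ‖`, which tends to zero by Scheffé; `hcont`
  -- supplies convergence of the masses.
  have hsch := tendsto_integral_abs_sub_of_tendsto_integral (μ := volume) (l := 𝓝[I] t)
    (F := fun s x => q s x * ‖ξ x‖) (f := fun x => q t x * ‖ξ x‖)
    (hI.mono fun s hs => hintn s hs)
    (hI.mono fun s hs x => mul_nonneg (hq0 s hs x) (norm_nonneg _))
    (hintn t ht) (fun x => mul_nonneg (hq0 t ht x) (norm_nonneg _))
    (fun x => (hasDerivWithinAt_density hq ht x).continuousWithinAt.tendsto.mul_const _)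
    (by
      have h := (hcont t ht).tendsto
      rw [integral_densityMeasure (hmeas t ht) (hq0 t ht)] at h
      refine h.congr' ?_
      filter_upwards [hI] with s hs
      rw [integral_densityMeasure (hmeas s hs) (hq0 s hs)]
      rfl)
  refine tendsto_iff_norm_sub_tendsto_zero.2 (squeeze_zero' (Eventually.of_forall fun s =>
    norm_nonneg _) ?_ hsch)
  filter_upwards [hI] with s hs
  rw [meanFeature, meanFeature, integral_densityMeasure (hmeas s hs) (hq0 s hs),
    integral_densityMeasure (hmeas t ht) (hq0 t ht), ← integral_sub (hint' s hs) (hint' t ht)]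
  refine (norm_integral_le_integral_norm _).trans_eq (integral_congr_ae (ae_of_all _ fun x => ?_))
  simp only
  rw [← sub_smul, norm_smul, Real.norm_eq_abs, ← sub_mul, abs_mul, abs_of_nonneg (norm_nonneg (ξ x))]

end MeanFeature

/-! ### The density ratio along a trajectory. -/

section Trajectory

variable {d : ℕ} {p ρ : Space d → ℝ} {I : Set ℝ} {q : ℝ → Space d → ℝ}

theorem divergence_smul {f : Space d → ℝ} {F : Space d → Space d} {y : Space d}
    (hf : DifferentiableAt ℝ f y) (hF : DifferentiableAt ℝ F y) :
    divergence (fun z => f z • F z) y = fderiv ℝ f y (F y) + f y * divergence F y := by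
  have h := (hf.hasFDerivAt.smul hF.hasFDerivAt).fderiv
  have hexp : fderiv ℝ f y (F y) = ∑ i, fderiv ℝ f y (EuclideanSpace.single i 1) * F y i := by
    have : F y = ∑ i, F y i • (EuclideanSpace.single i (1 : ℝ)) := by
      ext j
      simp [Finset.sum_apply, Pi.single_apply]
    conv_lhs => rw [this]
    simp [mul_comm]
  rw [divergence, divergence, hexp, Finset.mul_sum, ← Finset.sum_add_distrib]
  refine Finset.sum_congr rfl fun i _ => ?_
  have h' : fderiv ℝ (fun z => f z • F z) y = _ := h
  rw [h']
  simp [add_comm]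

/-- With the weight `ρ / p`, the divergence relative to `p` becomes the Stein operator of `ρ`. -/
theorem divergence_weight_smul_add (hp : ContDiff ℝ 1 p) (hp_pos : ∀ x, 0 < p x)
    (hρ : ContDiff ℝ 1 ρ) (hρ_pos : ∀ x, 0 < ρ x) {F : Space d → Space d} {y : Space d}
    (hF : DifferentiableAt ℝ F y) :
    divergence (fun z => weight p ρ z • F z) y + fderiv ℝ p y (weight p ρ y • F y) / p y
      = weight p ρ y * steinVector ρ F y := by
  have hpd := (hp.differentiable (by norm_num) y).hasFDerivAt
  have hρd := (hρ.differentiable (by norm_num) y).hasFDerivAt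
  have hp0 := (hp_pos y).ne'
  have hρ0 := (hρ_pos y).ne'
  have hscore : inner ℝ (score ρ y) (F y) = (ρ y)⁻¹ * fderiv ℝ ρ y (F y) := by
    rw [score, gradient, InnerProductSpace.toDual_symm_apply, (hρd.log hρ0).fderiv]
    simp
  have hw := (contDiff_weight hp hp_pos hρ).differentiable (by norm_num) y
  -- Differentiating `w p = ρ` is what brings in the score of `ρ` in place of that of `p`.
  have hwp : (fun z => weight p ρ z * p z) = ρ :=
    funext fun z => div_mul_cancel₀ _ (hp_pos z).ne'
  have hprod : fderiv ℝ ρ y (F y)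
      = weight p ρ y * fderiv ℝ p y (F y) + p y * fderiv ℝ (weight p ρ) y (F y) := by
    have h : HasFDerivAt (fun z => weight p ρ z * p z) _ y := hw.hasFDerivAt.mul hpd
    rw [hwp] at h
    rw [h.fderiv]
    simp
  have hρw : ρ y = weight p ρ y * p y := (congrFun hwp y).symm
  have hw0 := (weight_pos hp_pos hρ_pos y).ne'
  rw [divergence_smul hw hF, steinVector, hscore, map_smul, hprod, hρw, smul_eq_mul]
  field_simp
  ring

/-- The derivative of a moving density along a path that it transports. -/
theorem hasDerivWithinAt_density_comp (hI : I.OrdConnected)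
    (hq : ContDiffOn ℝ 1 (fun z : ℝ × Space d => q z.1 z.2) (I ×ˢ univ)) {t : ℝ} (ht : t ∈ I)
    {F : Space d → Space d} {x : ℝ → Space d} (hF : DifferentiableAt ℝ F (x t))
    (hcont : ∀ y, HasDerivWithinAt (fun s => q s y) (-divergence (fun z => q t z • F z) y) I t)
    (hx : HasDerivWithinAt x (F (x t)) I t) :
    HasDerivWithinAt (fun s => q s (x s)) (-(q t (x t) * divergence F (x t))) I t := by
  rcases I.subsingleton_or_nontrivial with hsub | hne
  · exact hasDerivWithinAt_iff_hasFDerivWithinAt.2 (.of_subsingleton hsub)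
  set L := fderivWithin ℝ (fun z : ℝ × Space d => q z.1 z.2) (I ×ˢ univ) (t, x t) with hL
  have hLd : HasFDerivWithinAt (fun z : ℝ × Space d => q z.1 z.2) L (I ×ˢ univ) (t, x t) :=
    (hq.differentiableOn (by norm_num) (t, x t) ⟨ht, mem_univ _⟩).hasFDerivWithinAt
  have h1 := hLd.comp_hasDerivWithinAt (f := fun s => (s, x s)) t
    ((hasDerivWithinAt_id t I).prodMk hx) fun s hs => ⟨hs, mem_univ _⟩
  have hqt := (contDiff_density hq ht).differentiable (by norm_num) (x t)
  have h2 : L (1, 0) = -divergence (fun z => q t z • F z) (x t) :=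
    (uniqueDiffOn_of_ordConnected hI hne t ht).eq_deriv _ (hasDerivWithinAt_density hq ht (x t))
      (hcont (x t))
  have h3 : L.comp (ContinuousLinearMap.inr ℝ ℝ (Space d)) = fderiv ℝ (q t) (x t) := by
    have h := hLd.comp (s := univ) (f := fun y => (t, y)) (x t)
      (hasFDerivAt_prodMk_right t (x t)).hasFDerivWithinAt fun y _ => ⟨ht, mem_univ y⟩
    rw [hasFDerivWithinAt_univ] at h
    exact h.fderiv.symm
  have h4 : L (0, F (x t)) = fderiv ℝ (q t) (x t) (F (x t)) := by
    rw [← h3]; simp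
  -- The transport term `F · ∇q` cancels against the same term in `-div (q F)`.
  have h5 : L (1, F (x t)) = -(q t (x t) * divergence F (x t)) := by
    have : ((1, F (x t)) : ℝ × Space d) = (1, 0) + (0, F (x t)) := by simp
    rw [this, map_add, h2, h4, divergence_smul hqt hF]
    ring
  rw [← h5]
  exact h1

/-- The derivative of the density ratio along a path of the flow with speed factor `ρ / p`. -/
theorem hasDerivWithinAt_density_ratio (hp : ContDiff ℝ 1 p) (hp_pos : ∀ x, 0 < p x)
    (hρ : ContDiff ℝ 1 ρ) (hρ_pos : ∀ x, 0 < ρ x) (hI : I.OrdConnected)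
    (hq : ContDiffOn ℝ 1 (fun z : ℝ × Space d => q z.1 z.2) (I ×ˢ univ)) {t : ℝ} (ht : t ∈ I)
    {F : Space d → Space d} {x : ℝ → Space d} (hF : DifferentiableAt ℝ F (x t))
    (hcont : ∀ y, HasDerivWithinAt (fun s => q s y)
      (-divergence (fun z => q t z • (weight p ρ z • F z)) y) I t)
    (hx : HasDerivWithinAt x (weight p ρ (x t) • F (x t)) I t) :
    HasDerivWithinAt (fun s => q s (x s) / p (x s))
      (-(weight p ρ (x t) * steinVector ρ F (x t)) * (q t (x t) / p (x t))) I t := by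
  have hw := (contDiff_weight hp hp_pos hρ).differentiable (by norm_num) (x t)
  have h1 := hasDerivWithinAt_density_comp hI hq ht (F := fun z => weight p ρ z • F z)
    (hw.fun_smul hF) hcont hx
  have h2 := (hp.differentiable (by norm_num) (x t)).hasFDerivAt.comp_hasDerivWithinAt t hx
  have hp0 := (hp_pos (x t)).ne'
  have h3 := h1.fun_div h2 hp0
  refine h3.congr_deriv ?_
  rw [← divergence_weight_smul_add hp hp_pos hρ hρ_pos hF]
  simp only [Function.comp_apply]
  field_simp
  ring

/-- The solution formula for a scalar linear equation. -/
theorem eq_mul_exp_of_hasDerivWithinAt (hI : I.OrdConnected) {z c : ℝ → ℝ}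
    (hc : ContinuousOn c I) (hz : ∀ t ∈ I, HasDerivWithinAt z (-(c t) * z t) I t)
    {t s : ℝ} (ht : t ∈ I) (hs : s ∈ I) :
    z s = z t * Real.exp (-∫ r in t..s, c r) := by
  -- Integrating factor: this product has zero derivative, hence is constant on the interval.
  have hder : ∀ r ∈ I, HasDerivWithinAt (fun r => z r * Real.exp (∫ u in t..r, c u)) 0 I r := by
    intro r hr
    have h := (hz r hr).mul
      (hasDerivWithinAt_intervalIntegral_of_continuousOn hI hc ht hr).exp
    refine h.congr_deriv ?_
    ring
  have h := Convex.norm_image_sub_le_of_norm_hasDerivWithin_le (C := 0) hder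
    (fun r _ => by simp) hI.convex ht hs
  rw [zero_mul, norm_le_zero_iff, sub_eq_zero, intervalIntegral.integral_same, Real.exp_zero,
    mul_one] at h
  rw [← h, mul_assoc, ← Real.exp_add, add_neg_cancel, Real.exp_zero, mul_one]

end Trajectory

theorem integrable_comp_of_hasLaw {d : ℕ} {Ω : Type*} [MeasurableSpace Ω] {P : Measure Ω}
    {E : Type*} [NormedAddCommGroup E] {μ : Measure (Space d)}
    {Y : Ω → Space d} (hY : HasLaw Y μ P) {g : Space d → E} (hg : AEStronglyMeasurable g μ) :
    Integrable (fun ω => g (Y ω)) P ↔ Integrable g μ := by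
  rw [← hY.map_eq] at hg ⊢
  exact (integrable_map_measure hg hY.aemeasurable).symm

/-! ### The integrated entropy identity. -/

section Entropy

variable {d : ℕ} {Ω : Type*} [MeasurableSpace Ω] {P : Measure Ω} [IsProbabilityMeasure P]
  {H : Type*} [NormedAddCommGroup H] [InnerProductSpace ℝ H] [CompleteSpace H]
  {p ρ : Space d → ℝ} {K : Space d → H}
  {I : Set ℝ} {X : ℝ → Ω → Space d} {q : ℝ → Space d → ℝ}

/-- The expected dissipation along the flow, integrated over time. -/
theorem integral_intervalIntegral_inner (hI : I.OrdConnected)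
    (hcw : Continuous fun x => weight p ρ x • steinFeature ρ K x)
    (hX : ∀ t ∈ I, HasLaw (X t) (densityMeasure (q t)) P)
    (hXc : ∀ᵐ ω ∂P, ContinuousOn (fun t => X t ω) I)
    (hint : ∀ t ∈ I, Integrable (fun x => weight p ρ x • steinFeature ρ K x)
      (densityMeasure (q t)))
    (hcont : ContinuousOn (fun t => ∫ x, ‖weight p ρ x • steinFeature ρ K x‖
      ∂(densityMeasure (q t))) I)
    (hm : ContinuousOn (fun t => meanFeature p ρ K (densityMeasure (q t))) I)
    {t s : ℝ} (ht : t ∈ I) (hs : s ∈ I) :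
    Integrable (fun ω => ∫ r in t..s, (inner ℝ (meanFeature p ρ K (densityMeasure (q r)))
      (weight p ρ (X r ω) • steinFeature ρ K (X r ω)) : ℝ)) P ∧
    ∫ ω, (∫ r in t..s, (inner ℝ (meanFeature p ρ K (densityMeasure (q r)))
      (weight p ρ (X r ω) • steinFeature ρ K (X r ω)) : ℝ)) ∂P
      = ∫ r in t..s, ‖meanFeature p ρ K (densityMeasure (q r))‖ ^ 2 := by
  set ξ := fun x => weight p ρ x • steinFeature ρ K x with hξ
  set m := fun t => meanFeature p ρ K (densityMeasure (q t)) with hmdef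
  have hJ : uIcc t s ⊆ I := hI.uIcc_subset ht hs
  set ν : Measure ℝ := volume.restrict (uIoc t s) with hν
  have hνI : ∀ᵐ r ∂ν, r ∈ uIcc t s :=
    (ae_restrict_mem measurableSet_uIoc).mono fun r hr => uIoc_subset_uIcc hr
  have : IsFiniteMeasure ν := by
    rw [hν, uIoc]; infer_instance
  have hXm : AEMeasurable (fun z : ℝ × Ω => X z.1 z.2) (ν.prod P) :=
    aemeasurable_uncurry_of_ae_continuousOn (J := I) (fun r hr => (hX r hr).aemeasurable) hXc
      (hνI.mono fun r hr => hJ hr)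
  have hξX : ∀ r ∈ I, Integrable (fun ω => ξ (X r ω)) P := fun r hr =>
    (integrable_comp_of_hasLaw (hX r hr) (hint r hr).1).2 (hint r hr)
  have hmm : AEStronglyMeasurable m ν :=
    ((hm.mono hJ).aestronglyMeasurable measurableSet_uIcc).mono_measure
      (Measure.restrict_mono uIoc_subset_uIcc le_rfl)
  have hcm : AEStronglyMeasurable (fun z : ℝ × Ω => (inner ℝ (m z.1) (ξ (X z.1 z.2)) : ℝ))
      (ν.prod P) := by
    refine hmm.comp_fst.inner ?_
    exact hcw.comp_aestronglyMeasurable hXm.aestronglyMeasurable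
  -- `C` bounds `‖m_r‖ E‖w Φ(X_r)‖` on the compact time interval, giving the absolute integrability
  -- that Fubini needs.
  obtain ⟨C, hC⟩ := isCompact_uIcc.exists_bound_of_continuousOn
    ((hm.mono hJ).norm.mul (hcont.mono hJ))
  have hprod : Integrable (fun z : ℝ × Ω => (inner ℝ (m z.1) (ξ (X z.1 z.2)) : ℝ))
      (ν.prod P) := by
    rw [integrable_prod_iff hcm]
    refine ⟨?_, ?_⟩
    · filter_upwards [hνI] with r hr
      exact (hξX r (hJ hr)).const_inner (m r)
    · refine Integrable.of_bound hcm.norm.integral_prod_right' C ?_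
      filter_upwards [hνI] with r hr
      refine le_trans ?_ (hC r hr)
      have hnorm : ∫ ω, ‖ξ (X r ω)‖ ∂P = ∫ x, ‖ξ x‖ ∂(densityMeasure (q r)) :=
        (hX r (hJ hr)).integral_comp (hint r (hJ hr)).1.norm
      rw [Real.norm_of_nonneg (integral_nonneg fun _ => norm_nonneg _)]
      refine le_trans ?_ (le_abs_self _)
      change _ ≤ ‖m r‖ * ∫ x, ‖ξ x‖ ∂(densityMeasure (q r))
      rw [← hnorm, ← integral_const_mul]
      exact integral_mono ((hξX r (hJ hr)).const_inner (m r)).norm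
        ((hξX r (hJ hr)).norm.const_mul _) fun ω => norm_inner_le_norm _ _
  have hinner : ∀ᵐ r ∂ν, ∫ ω, (inner ℝ (m r) (ξ (X r ω)) : ℝ) ∂P = ‖m r‖ ^ 2 := by
    filter_upwards [hνI] with r hr
    rw [integral_inner (hξX r (hJ hr)), ← real_inner_self_eq_norm_sq]
    congr 1
    exact (hX r (hJ hr)).integral_comp (hint r (hJ hr)).1
  simp_rw [intervalIntegral.intervalIntegral_eq_integral_uIoc]
  -- The sign covers both orders of `t` and `s`.
  refine ⟨hprod.integral_prod_right.smul (if t ≤ s then (1 : ℝ) else -1), ?_⟩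
  rw [integral_smul, ← integral_integral_swap hprod, integral_congr_ae hinner]

/-- The evolution of the relative entropy along the flow with speed factor `ρ / p`. -/
theorem integral_log_density_ratio_sub
    (hp : ContDiff ℝ 1 p) (hp_pos : ∀ x, 0 < p x)
    (hρ : ContDiff ℝ 1 ρ) (hρ_pos : ∀ x, 0 < ρ x) (hK : ContDiff ℝ 1 K) (hI : I.OrdConnected)
    (hq0 : ∀ t ∈ I, ∀ x, 0 ≤ q t x)
    (hq : ContDiffOn ℝ 1 (fun z : ℝ × Space d => q z.1 z.2) (I ×ˢ univ))
    (hX : ∀ t ∈ I, HasLaw (X t) (densityMeasure (q t)) P)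
    (hint : ∀ t ∈ I, Integrable (fun x => weight p ρ x • steinFeature ρ K x)
      (densityMeasure (q t)))
    (hcont : ContinuousOn (fun t => ∫ x, ‖weight p ρ x • steinFeature ρ K x‖
      ∂(densityMeasure (q t))) I)
    (hode : ∀ᵐ ω ∂P, ∀ t ∈ I, HasDerivWithinAt (fun s => X s ω)
      (weight p ρ (X t ω) • featureField K (meanFeature p ρ K (densityMeasure (q t))) (X t ω)) I t)
    (hce : ∀ t ∈ I, ∀ y, HasDerivWithinAt (fun s => q s y) (-divergence (fun z => q t z •
      (weight p ρ z • featureField K (meanFeature p ρ K (densityMeasure (q t))) z)) y) I t)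
    {t s : ℝ} (ht : t ∈ I) (hs : s ∈ I)
    (hlog : Integrable (fun x => Real.log (q t x / p x)) (densityMeasure (q t))) :
    Integrable (fun x => Real.log (q s x / p x)) (densityMeasure (q s)) ∧
    ∫ x, Real.log (q s x / p x) ∂(densityMeasure (q s))
      = ∫ x, Real.log (q t x / p x) ∂(densityMeasure (q t))
        - ∫ r in t..s, ‖meanFeature p ρ K (densityMeasure (q r))‖ ^ 2 := by
  have hcw := continuous_weight_smul_steinFeature hp hp_pos hρ hρ_pos hK
  have hm := continuousOn_meanFeature hq0 hq hint hcont
  have hXc : ∀ᵐ ω ∂P, ContinuousOn (fun t => X t ω) I := by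
    filter_upwards [hode] with ω hω t ht
    exact (hω t ht).continuousWithinAt
  obtain ⟨hi, he⟩ := integral_intervalIntegral_inner hI hcw hX hXc hint hcont hm ht hs
  have hmeas : ∀ r ∈ I, Measurable fun x => Real.log (q r x / p x) := fun r hr =>
    ((contDiff_density hq hr).continuous.measurable.div hp.continuous.measurable).log
  -- A random point almost surely avoids the zeros of its density; this makes the logarithm of the
  -- product formula split.
  have hpos : ∀ᵐ ω ∂P, 0 < q t (X t ω) := by
    have hqm := (contDiff_density hq ht).continuous.measurable
    have hset : MeasurableSet {x | 0 < q t x} := measurableSet_lt measurable_const hqm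
    rw [(hX t ht).ae_iff (p := fun x => 0 < q t x) (measurableSet_setOfPred.1 hset), densityMeasure,
      ae_withDensity_iff hqm.ennreal_ofReal]
    refine ae_of_all _ fun x hx => ?_
    exact ENNReal.ofReal_pos.1 (pos_iff_ne_zero.2 hx)
  have hpath : ∀ᵐ ω ∂P, Real.log (q s (X s ω) / p (X s ω)) = Real.log (q t (X t ω) / p (X t ω))
      - ∫ r in t..s, (inner ℝ (meanFeature p ρ K (densityMeasure (q r)))
        (weight p ρ (X r ω) • steinFeature ρ K (X r ω)) : ℝ) := by
    filter_upwards [hode, hXc, hpos] with ω hω hωc hω0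
    have hz := eq_mul_exp_of_hasDerivWithinAt hI (z := fun r => q r (X r ω) / p (X r ω))
      (c := fun r => inner ℝ (meanFeature p ρ K (densityMeasure (q r)))
        (weight p ρ (X r ω) • steinFeature ρ K (X r ω)))
      (hm.inner (hcw.comp_continuousOn hωc)) (fun r hr => by
        have := hasDerivWithinAt_density_ratio hp hp_pos hρ hρ_pos hI hq hr
          ((contDiff_featureField hK (meanFeature p ρ K (densityMeasure (q r)))).differentiable
            (by norm_num) (X r ω)) (hce r hr) (x := fun s => X s ω) (hω r hr)
        rw [steinVector_featureField hK] at this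
        rw [inner_smul_right]
        exact this) ht hs
    rw [hz, Real.log_mul (div_pos hω0 (hp_pos _)).ne' (Real.exp_pos _).ne', Real.log_exp,
      sub_eq_add_neg]
  have hLt : Integrable (fun ω => Real.log (q t (X t ω) / p (X t ω))) P :=
    (integrable_comp_of_hasLaw (hX t ht) hlog.1).2 hlog
  have hms := (hmeas s hs).aestronglyMeasurable (μ := densityMeasure (q s))
  constructor
  · refine (integrable_comp_of_hasLaw (hX s hs) hms).1 ?_
    exact (hLt.sub hi).congr (hpath.mono fun ω hω => hω.symm)
  · have e1 := (hX s hs).integral_comp hms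
    have e2 := (hX t ht).integral_comp hlog.1
    simp only [Function.comp_def] at e1 e2
    rw [← e1, ← e2, integral_congr_ae hpath, integral_sub hLt hi, he]

end Entropy

end GFSVGD

end

theorem mainTheorem6 {d : ℕ} {Ω : Type*} [MeasurableSpace Ω]
    (P : Measure Ω) [IsProbabilityMeasure P]
    (p ρ : GFSVGD.Space d → ℝ) (k : GFSVGD.Space d → GFSVGD.Space d → ℝ)
    (hp : ContDiff ℝ 1 p) (hp_pos : ∀ x, 0 < p x) (hp_one : ∫ x, p x = 1)
    (hρ : ContDiff ℝ 1 ρ) (hρ_pos : ∀ x, 0 < ρ x)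
    (hk : ContDiff ℝ 2 (fun z : GFSVGD.Space d × GFSVGD.Space d => k z.1 z.2))
    (hk_pos : (Matrix.of k).PosSemidef)
    (a : GFSVGD.Space d → ℝ) (ha : ContDiff ℝ 1 a)
    (I : Set ℝ) (hI : I.OrdConnected)
    (X : ℝ → Ω → GFSVGD.Space d) (q : ℝ → GFSVGD.Space d → ℝ)
    (hflow : GFSVGD.IsMeanFieldFlow P p ρ k a I X q)
    (hint : ∀ t ∈ I, Integrable
      (fun x => GFSVGD.weight p ρ x * √(GFSVGD.steinKernel ρ k x x))
      (GFSVGD.densityMeasure (q t)))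
    (hcont : ContinuousOn
      (fun t => ∫ x, GFSVGD.weight p ρ x * √(GFSVGD.steinKernel ρ k x x)
        ∂(GFSVGD.densityMeasure (q t))) I) :
    -- the continuity equation
    (∀ t ∈ I, ∀ y,
      Integrable (fun x => GFSVGD.drift p ρ k x y) (GFSVGD.densityMeasure (q t)) ∧
      DifferentiableAt ℝ
        (fun z => q t z • (a z • GFSVGD.meanField p ρ k (GFSVGD.densityMeasure (q t)) z)) y ∧
      HasDerivWithinAt (fun s => q s y)
        (-GFSVGD.divergence
          (fun z => q t z • (a z • GFSVGD.meanField p ρ k (GFSVGD.densityMeasure (q t)) z)) y)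
        I t) ∧
    -- the dissipation of the Kullback-Leibler divergence
    (a = GFSVGD.weight p ρ →
      (∃ t₀ ∈ I, InformationTheory.klDiv (GFSVGD.densityMeasure (q t₀))
        (GFSVGD.densityMeasure p) ≠ ∞) →
      ∀ t ∈ I,
        InformationTheory.klDiv (GFSVGD.densityMeasure (q t)) (GFSVGD.densityMeasure p) ≠ ∞ ∧
        Integrable
          (fun z : GFSVGD.Space d × GFSVGD.Space d =>
            GFSVGD.weight p ρ z.1 * GFSVGD.weight p ρ z.2 * GFSVGD.steinKernel ρ k z.1 z.2)
          ((GFSVGD.densityMeasure (q t)).prod (GFSVGD.densityMeasure (q t))) ∧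
        HasDerivWithinAt
          (fun s => (InformationTheory.klDiv (GFSVGD.densityMeasure (q s))
            (GFSVGD.densityMeasure p)).toReal)
          (-∫ z : GFSVGD.Space d × GFSVGD.Space d,
            GFSVGD.weight p ρ z.1 * GFSVGD.weight p ρ z.2 * GFSVGD.steinKernel ρ k z.1 z.2
            ∂((GFSVGD.densityMeasure (q t)).prod (GFSVGD.densityMeasure (q t)))) I t ∧
        -(∫ z : GFSVGD.Space d × GFSVGD.Space d,
            GFSVGD.weight p ρ z.1 * GFSVGD.weight p ρ z.2 * GFSVGD.steinKernel ρ k z.1 z.2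
            ∂((GFSVGD.densityMeasure (q t)).prod (GFSVGD.densityMeasure (q t)))) ≤ 0) ∧
    -- the explicit form of the kernel
    (∀ x y, GFSVGD.steinKernel ρ k x y =
      k x y * inner ℝ (GFSVGD.score ρ x) (GFSVGD.score ρ y)
        + inner ℝ (GFSVGD.score ρ x) (gradient (fun y' => k x y') y)
        + inner ℝ (GFSVGD.score ρ y) (gradient (fun x' => k x' y) x)
        + GFSVGD.divergence (fun x' => gradient (fun y' => k x' y') y) x) := by
  obtain ⟨H, _, _, _, K, hkK⟩ := GFSVGD.exists_featureMap k hk_pos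
  have hK : ContDiff ℝ 1 K := GFSVGD.contDiff_featureMap (by simpa only [hkK] using hk)
  obtain ⟨hq0, hq, hX, hode⟩ := hflow
  have hcw := GFSVGD.continuous_weight_smul_steinFeature hp hp_pos hρ hρ_pos hK
  have hnorm := GFSVGD.norm_weight_smul_steinFeature hp_pos hρ_pos hK hkK
  simp only [← hnorm] at hint hcont
  have hint' : ∀ t ∈ I, Integrable (fun x => GFSVGD.weight p ρ x • GFSVGD.steinFeature ρ K x)
      (GFSVGD.densityMeasure (q t)) := fun t ht =>
    (integrable_norm_iff hcw.aestronglyMeasurable).1 (hint t ht)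
  have hm := GFSVGD.continuousOn_meanFeature hq0 hq hint' hcont
  have hmf : ∀ t ∈ I, GFSVGD.meanField p ρ k (GFSVGD.densityMeasure (q t)) =
      GFSVGD.featureField K (GFSVGD.meanFeature p ρ K (GFSVGD.densityMeasure (q t))) :=
    fun t ht => GFSVGD.meanField_eq hK hkK (hint' t ht)
  have hF : ∀ t ∈ I, ContDiff ℝ 1 (GFSVGD.meanField p ρ k (GFSVGD.densityMeasure (q t))) := by
    intro t ht
    rw [hmf t ht]
    exact GFSVGD.contDiff_featureField hK _
  -- Continuity of `m` gives `‖m s‖ < ‖m t‖ + 1` near `t`, and `A` bounds `|a| ‖K‖` on the compact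
  -- set.
  have hv : ∀ t ∈ I, ∀ C : Set (GFSVGD.Space d), IsCompact C →
      ∃ M, ∀ᶠ s in nhdsWithin t I, ∀ y ∈ C,
        ‖a y • GFSVGD.meanField p ρ k (GFSVGD.densityMeasure (q s)) y‖ ≤ M := by
    intro t ht C hC
    obtain ⟨A, hA⟩ := hC.exists_bound_of_continuousOn
      (ha.continuous.norm.mul hK.continuous.norm).continuousOn
    set m := fun s => GFSVGD.meanFeature p ρ K (GFSVGD.densityMeasure (q s))
    refine ⟨(‖m t‖ + 1) * A, ?_⟩
    filter_upwards [(hm t ht).norm.eventually (gt_mem_nhds (lt_add_one ‖m t‖)),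
      self_mem_nhdsWithin] with s hs hsI y hy
    rw [hmf s hsI, norm_smul]
    have h1 := GFSVGD.norm_featureField_le (K := K) (m s) y
    have h2 : ‖a y‖ * ‖K y‖ ≤ A := (le_abs_self _).trans (hA y hy)
    calc ‖a y‖ * ‖GFSVGD.featureField K (m s) y‖ ≤ ‖a y‖ * (‖m s‖ * ‖K y‖) := by gcongr
      _ = ‖m s‖ * (‖a y‖ * ‖K y‖) := by ring
      _ ≤ (‖m t‖ + 1) * A := by gcongr
  have hce : ∀ t ∈ I, ∀ y, HasDerivWithinAt (fun s => q s y) (-GFSVGD.divergence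
      (fun z => q t z • (a z • GFSVGD.meanField p ρ k (GFSVGD.densityMeasure (q t)) z)) y) I t :=
    fun t ht y => GFSVGD.continuity_equation
      (v := fun s z => a z • GFSVGD.meanField p ρ k (GFSVGD.densityMeasure (q s)) z)
      hI hq0 hq hX hode ht (ha.smul (hF t ht)) (hv t ht) y
  refine ⟨fun t ht y => ⟨GFSVGD.integrable_drift hK hkK (hint' t ht) y, ?_, hce t ht y⟩, ?_,
    GFSVGD.steinKernel_eq hK hkK⟩
  · exact ((GFSVGD.contDiff_density hq ht).smul (ha.smul (hF t ht))).differentiable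
      (by norm_num) y
  rintro rfl ⟨t₀, ht₀, hkl⟩
  have hprob : ∀ t ∈ I, IsProbabilityMeasure (GFSVGD.densityMeasure (q t)) := fun t ht =>
    (hX t ht).isProbabilityMeasure_iff.1 inferInstance
  have := GFSVGD.isProbabilityMeasure_densityMeasure hp_pos hp_one
  have hpm := hp.continuous.measurable
  have hqm : ∀ t ∈ I, Measurable (q t) := fun t ht =>
    (GFSVGD.contDiff_density hq ht).continuous.measurable
  -- The identity holds between any two times: based at `t₀` it spreads finiteness over `I`, based
  -- at `t` it gives the derivative there.
  have hent := fun {t s : ℝ} (ht : t ∈ I) (hs : s ∈ I) =>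
    GFSVGD.integral_log_density_ratio_sub hp hp_pos hρ hρ_pos hK hI hq0 hq hX hint' hcont
      (hode.mono fun ω hω r hr => by simpa only [← hmf r hr] using hω r hr)
      (fun r hr y => by simpa only [← hmf r hr] using hce r hr y) ht hs
  have hlog : ∀ t ∈ I, Integrable (fun x => Real.log (q t x / p x))
      (GFSVGD.densityMeasure (q t)) := fun t ht =>
    (hent ht₀ ht ((GFSVGD.klDiv_densityMeasure_ne_top_iff (hqm t₀ ht₀) (hq0 t₀ ht₀) hpm
      hp_pos).1 hkl)).1
  intro t ht
  have := hprob t ht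
  rw [GFSVGD.integral_steinKernel_prod hK hkK (hint' t ht)]
  refine ⟨(GFSVGD.klDiv_densityMeasure_ne_top_iff (hqm t ht) (hq0 t ht) hpm hp_pos).2 (hlog t ht),
    GFSVGD.integrable_steinKernel_prod hK hkK (hint' t ht), ?_, by simp⟩
  have hkl_eq : ∀ s ∈ I, (InformationTheory.klDiv (GFSVGD.densityMeasure (q s))
      (GFSVGD.densityMeasure p)).toReal
      = ∫ x, Real.log (q t x / p x) ∂(GFSVGD.densityMeasure (q t))
        - ∫ r in t..s, ‖GFSVGD.meanFeature p ρ K (GFSVGD.densityMeasure (q r))‖ ^ 2 := by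
    intro s hs
    have := hprob s hs
    rw [GFSVGD.toReal_klDiv_densityMeasure (hqm s hs) (hq0 s hs) hpm hp_pos]
    exact (hent ht hs (hlog t ht)).2
  exact ((GFSVGD.hasDerivWithinAt_intervalIntegral_of_continuousOn hI (hm.norm.pow 2) ht
    ht).const_sub _).congr_of_mem hkl_eq ht
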